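/- Let $n\ge 0$, let $V\in C([0,1];\mathbb R^{n\times n})$ with $V(x)$ symmetric for every $x$, and let $\alpha_1,\alpha_2,\beta_1,\beta_2\in\mathbb R^{n\times n}$ satisfy $\operatorname{rank}[\alpha_1\ \alpha_2]=\operatorname{rank}[\beta_1\ \beta_2]=n$, $\alpha_1\alpha_2^t-\alpha_2\alpha_1^t=0$ and $\beta_1\beta_2^t-\beta_2\beta_1^t=0$. Let $H=-\frac{d^2}{dx^2}+V$ in $L^2((0,1);\mathbb R^n)$ with domain $$\{y\in H^2(0,1):\ \alpha_1y(0)+\alpha_2y'(0)=0,\ \beta_1y(1)+\beta_2y'(1)=0\},$$ and let the Morse index $\operatorname{Mor}(H)$ be the number of negative eigenvalues of $H$, counted with multiplicity. For $\lambda\in\mathbb R$ let $\ell(1,\lambda)\subset\mathbb R^{2n}$ be the set of the values $(y(1),y'(1))$ of all solutions of $-y''+Vy=\lambda y$ on $[0,1]$ with $\alpha_1y(0)+\alpha_2y'(0)=0$, and let $\ell_1=\{(p,q)\in\mathbb R^{2n}:\beta_1p+\beta_2q=0\}$. Maslov index. Let $J=\begin{pmatrix}0&-I_n\\ I_n&0\end{pmatrix}$;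 a subspace $\ell\subset\mathbb R^{2n}$ is Lagrangian if $\dim\ell=n$ and $(Jx,y)_{\mathbb R^{2n}}=0$ for all $x,y\in\ell$. Let $\Pi_\ell$ be the orthogonal projection onto $\ell$. For Lagrangian $\ell$ the matrix $W=(I-2\Pi_\ell)(2\Pi_{\ell_1}-I)$ commutes with $J$, so it has the form $\begin{pmatrix}W_{11}&-W_{21}\\ W_{21}&W_{11}\end{pmatrix}$, and $\tilde W=W_{11}+iW_{21}$ is a unitary $n\times n$ matrix. For a continuous path $\Upsilon$ of Lagrangian subspaces on $[a,b]$, with matrices $\tilde W_t$, choose $a=t_0<\dots<t_N=b$ and $\epsilon_j\in(0,\pi)$ with $e^{i(\pi\pm\epsilon_j)}\notin\sigma(\tilde W_t)$ for $t\in[t_{j-1},t_j]$, and put $$\operatorname{Mas}(\Upsilon,\ell_1;[a,b])=\sum_{j=1}^N\big(k(t_j,\epsilon_j)-k(t_{j-1},\epsilon_j)\big),\qquad k(t,\epsilon)=\sum_{0\le\theta<\epsilon}\dim\ker\big(\tilde W_t-e^{i(\pi+\theta)}I\big).$$ Then $\operatorname{Mor}(H)$ is finite, and there is $\lambda_\infty>0$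 such that $\ell(1,\lambda)\cap\ell_1=\{0\}$ for all $\lambda<-\lambda_\infty$. For every $\lambda_\infty>0$ with this property, let $\Gamma_3$ be the path $\lambda=-t$, $t\in[0,\lambda_\infty]$, along which $\lambda$ decreases from $0$ to $-\lambda_\infty$. Then $\ell(1,\cdot)$ is a continuous path of Lagrangian subspaces along $\Gamma_3$, $\ell_1$ is Lagrangian, the Maslov index of the path is defined (partitions as above exist, and all of them give the same value), and $$\operatorname{Mas}(\ell,\ell_1;\Gamma_3)=\operatorname{Mor}(H).$$ -/

import Mathlib

open MeasureTheory

noncomputable section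

namespace MaslovMorse

variable {n : ℕ}

/-- `ℝⁿ` with the Euclidean inner product. -/
abbrev Vec (n : ℕ) : Type := EuclideanSpace ℝ (Fin n)

/-- `ℝ²ⁿ` with the Euclidean inner product; a vector is a pair `(p, q)`, where `p` has the
coordinates indexed by `Sum.inl` and `q` those indexed by `Sum.inr`. -/
abbrev PhaseSpace (n : ℕ) : Type := EuclideanSpace ℝ (Fin n ⊕ Fin n)

/-- Real `2n × 2n` matrices in `n × n` blocks. -/
abbrev PhaseMatrix (n : ℕ) : Type := Matrix (Fin n ⊕ Fin n) (Fin n ⊕ Fin n) ℝ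

/-! ### Lagrangian subspaces and the Maslov index -/

/-- The standard symplectic matrix with blocks `0, -I` (first row) and `I, 0` (second row). -/
def symplJ (n : ℕ) : PhaseMatrix n := Matrix.fromBlocks 0 (-1) 1 0

/-- The symplectic form `ω(x, y) = (J x, y)`. -/
def omega (x y : PhaseSpace n) : ℝ := inner ℝ (Matrix.toEuclideanCLM (𝕜 := ℝ) (symplJ n) x) y

/-- A Lagrangian subspace: dimension `n`, and `ω` vanishes on it. -/
def IsLagrangian (l : Submodule ℝ (PhaseSpace n)) : Prop :=
  Module.finrank ℝ l = n ∧ ∀ x ∈ l, ∀ y ∈ l, omega x y = 0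

/-- The matrix of the orthogonal projection onto a subspace of `ℝ²ⁿ`. -/
def projMatrix (l : Submodule ℝ (PhaseSpace n)) : PhaseMatrix n :=
  (Matrix.toEuclideanCLM (𝕜 := ℝ) (n := Fin n ⊕ Fin n)).symm l.starProjection

/-- The conjugation `τ = 2 Π - I` of `ℝ²ⁿ` with respect to the target `l₁`. -/
def conjMatrix (l₁ : Submodule ℝ (PhaseSpace n)) : PhaseMatrix n :=
  2 * projMatrix l₁ - 1

/-- The matrix `W = (I - 2 Π_l) (2 Π_{l₁} - I)`. By `wMatrix_eq_mul` below, it is the matrix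
`U Uᵀ'` with `Uᵀ' = τ Uᵀ τ`, for any unitary matrix `U` which maps `l₁ᗮ` to `l`. -/
def wMatrix (l l₁ : Submodule ℝ (PhaseSpace n)) : PhaseMatrix n :=
  (1 - 2 * projMatrix l) * conjMatrix l₁

theorem wMatrix_eq_mul (l l₁ : Submodule ℝ (PhaseSpace n)) (U : PhaseMatrix n)
    (hU : U * U.transpose = 1)
    (hl : l = (l₁ᗮ).map
      (Matrix.toEuclideanCLM (𝕜 := ℝ) U : PhaseSpace n →ₗ[ℝ] PhaseSpace n)) :
    wMatrix l l₁ = U * (conjMatrix l₁ * U.transpose * conjMatrix l₁) := by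
  have hU' : U.transpose * U = 1 := mul_eq_one_comm.mp hU
  have hs : star U = U.transpose := by
    rw [Matrix.star_eq_conjTranspose, Matrix.conjTranspose_eq_transpose_of_trivial]
  set φ := Matrix.toEuclideanCLM (𝕜 := ℝ) (n := Fin n ⊕ Fin n) with hφ
  have hadj : ContinuousLinearMap.adjoint (φ U) = φ U.transpose := by
    rw [← ContinuousLinearMap.star_eq_adjoint, ← map_star, hs]
  have hinv : ∀ x, φ U.transpose (φ U x) = x := fun x => by
    rw [← mul_apply_eq_comp, ← map_mul, hU', map_one, one_apply_eq_self]
  have key : l.starProjection = φ (U * (1 - projMatrix l₁) * U.transpose) := by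
    have h1 : φ (1 - projMatrix l₁) = l₁ᗮ.starProjection := by
      rw [map_sub, map_one, projMatrix, StarAlgEquiv.apply_symm_apply,
        Submodule.starProjection_orthogonal']
    ext1 x
    rw [map_mul, map_mul, h1, mul_apply_eq_comp, mul_apply_eq_comp]
    apply Submodule.eq_starProjection_of_mem_orthogonal
    · rw [hl]
      exact Submodule.mem_map_of_mem (Submodule.starProjection_apply_mem _ _)
    · rw [hl, Submodule.mem_orthogonal]
      rintro _ ⟨k, hk, rfl⟩
      have h2 : ∀ z, inner ℝ (φ U k) z = inner ℝ k (φ U.transpose z) := fun z => by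
        rw [← hadj, ContinuousLinearMap.adjoint_inner_right]
      have h3 := Submodule.sub_starProjection_mem_orthogonal (K := l₁ᗮ) (φ U.transpose x)
      have h4 := (Submodule.mem_orthogonal _ _).1 h3 k hk
      change inner ℝ (φ U k) _ = 0
      rw [h2, map_sub, hinv]
      exact h4
  have hP : projMatrix l = U * (1 - projMatrix l₁) * U.transpose := by
    rw [projMatrix, key]
    exact StarAlgEquiv.symm_apply_apply _ _
  rw [wMatrix, hP]
  have : (1 - 2 * (U * (1 - projMatrix l₁) * U.transpose)) = U * conjMatrix l₁ * U.transpose := by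
    rw [conjMatrix]
    nth_rewrite 1 [← hU]
    noncomm_ring
  rw [this]
  simp only [mul_assoc]

/-- The complex `n × n` matrix `W₁₁ + i W₂₁` that corresponds to a real `2n × 2n` matrix `W`
commuting with `J`. -/
def complexMatrix (W : PhaseMatrix n) : Matrix (Fin n) (Fin n) ℂ :=
  W.toBlocks₁₁.map Complex.ofReal + Complex.I • W.toBlocks₂₁.map Complex.ofReal

/-- The complex unitary matrix `W̃` attached to a Lagrangian subspace `l` and the target `l₁`. -/
def wTilde (l l₁ : Submodule ℝ (PhaseSpace n)) : Matrix (Fin n) (Fin n) ℂ :=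
  complexMatrix (wMatrix l l₁)

/-- `ker (A - e^{i(π + θ)} I)`. -/
def circleEigenspace (A : Matrix (Fin n) (Fin n) ℂ) (θ : ℝ) : Submodule ℂ (Fin n → ℂ) :=
  Module.End.eigenspace (Matrix.toLin' A) (Complex.exp (Complex.I * ((Real.pi + θ : ℝ) : ℂ)))

/-- The number, with multiplicity, of the eigenvalues of `A` on the arc `e^{i(π + θ)}`,
`0 ≤ θ < ε`. For `ε ≤ 2π` only finitely many terms of the sum are nonzero. -/
def arcCount (A : Matrix (Fin n) (Fin n) ℂ) (ε : ℝ) : ℕ :=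
  ∑ᶠ θ ∈ Set.Ico (0 : ℝ) ε, Module.finrank ℂ (circleEigenspace A θ)

/-- A partition `a = t₀ < t₁ < ⋯ < t_N = b` and numbers `ε_j ∈ (0, π)` such that
`e^{i(π ± ε_j)}` is not an eigenvalue of `A t` for `t ∈ [t_{j-1}, t_j]`. -/
structure FlowPartition (A : ℝ → Matrix (Fin n) (Fin n) ℂ) (a b : ℝ) where
  N : ℕ
  t : Fin (N + 1) → ℝ
  ε : Fin N → ℝ
  strictMono : StrictMono t
  t_zero : t 0 = a
  t_last : t (Fin.last N) = b
  ε_mem : ∀ j, ε j ∈ Set.Ioo 0 Real.pi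
  gap : ∀ j, ∀ τ ∈ Set.Icc (t j.castSucc) (t j.succ),
    circleEigenspace (A τ) (ε j) = ⊥ ∧ circleEigenspace (A τ) (-ε j) = ⊥

/-- The sum `∑_j (k(t_j, ε_j) - k(t_{j-1}, ε_j))`. -/
def FlowPartition.flow {A : ℝ → Matrix (Fin n) (Fin n) ℂ} {a b : ℝ}
    (P : FlowPartition A a b) : ℤ :=
  ∑ j : Fin P.N,
    ((arcCount (A (P.t j.succ)) (P.ε j) : ℤ) - (arcCount (A (P.t j.castSucc)) (P.ε j) : ℤ))

/-- `m` is the Maslov index of the path `Υ : [a, b] → Λ(n)` with respect to the target `l₁`: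
the path is a continuous path of Lagrangian subspaces (for the distance `‖Π - Π'‖` between
the orthogonal projections), and the spectral flow of `W̃` through `-1` along it, computed
with any partition (and there is one), is `m`. -/
structure HasMaslovIndex (Υ : ℝ → Submodule ℝ (PhaseSpace n))
    (l₁ : Submodule ℝ (PhaseSpace n)) (a b : ℝ) (m : ℤ) : Prop where
  target : IsLagrangian l₁
  lagrangian : ∀ t ∈ Set.Icc a b, IsLagrangian (Υ t)
  continuous : ContinuousOn (fun t => projMatrix (Υ t)) (Set.Icc a b)
  exists_partition : Nonempty (FlowPartition (fun t => wTilde (Υ t) l₁) a b)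
  flow_eq : ∀ P : FlowPartition (fun t => wTilde (Υ t) l₁) a b, P.flow = m

/-! ### The Schrödinger operator and its Morse index -/

/-- `u` belongs to the Sobolev space `H¹(0, s)` (`u` being the continuous representative, on
`[0, s]`), with weak derivative `g ∈ L²(0, s)`. -/
def HasWeakDeriv {E : Type*} [NormedAddCommGroup E] [NormedSpace ℝ E] (s : ℝ)
    (u g : ℝ → E) : Prop :=
  MemLp g 2 (volume.restrict (Set.Icc 0 s)) ∧
    ∀ x ∈ Set.Icc 0 s, u x = u 0 + ∫ t in (0 : ℝ)..x, g t

theorem HasWeakDeriv.intervalIntegrable {E : Type*} [NormedAddCommGroup E] [NormedSpace ℝ E]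
    {s : ℝ} {u g : ℝ → E} (h : HasWeakDeriv s u g) {x : ℝ} (hx : x ∈ Set.Icc 0 s) :
    IntervalIntegrable g volume 0 x := by
  have h1 : IntegrableOn g (Set.Icc 0 s) volume := h.1.integrable one_le_two
  rw [intervalIntegrable_iff_integrableOn_Icc_of_le hx.1]
  exact h1.mono_set (Set.Icc_subset_Icc_right hx.2)

theorem HasWeakDeriv.add {E : Type*} [NormedAddCommGroup E] [NormedSpace ℝ E] {s : ℝ}
    {u g v k : ℝ → E} (h : HasWeakDeriv s u g) (h' : HasWeakDeriv s v k) :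
    HasWeakDeriv s (u + v) (g + k) := by
  refine ⟨h.1.add h'.1, fun x hx => ?_⟩
  have := intervalIntegral.integral_add (h.intervalIntegrable hx) (h'.intervalIntegrable hx)
  simp only [Pi.add_apply]
  rw [this, h.2 x hx, h'.2 x hx]
  abel

theorem HasWeakDeriv.smul {E : Type*} [NormedAddCommGroup E] [NormedSpace ℝ E] {s : ℝ}
    (c : ℝ) {u g : ℝ → E} (h : HasWeakDeriv s u g) : HasWeakDeriv s (c • u) (c • g) := by
  refine ⟨h.1.const_smul c, fun x hx => ?_⟩
  simp only [Pi.smul_apply]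
  rw [intervalIntegral.integral_smul, h.2 x hx, smul_add]

theorem HasWeakDeriv.zero {E : Type*} [NormedAddCommGroup E] [NormedSpace ℝ E] (s : ℝ) :
    HasWeakDeriv s (0 : ℝ → E) 0 :=
  ⟨MemLp.zero', fun x _ => by simp⟩

/-- The boundary conditions `α₁ y(0) + α₂ y'(0) = 0` and similar ones:
`a₁ p + a₂ q = 0`. -/
def BoundaryCond (a₁ a₂ : Matrix (Fin n) (Fin n) ℝ) (p q : Fin n → ℝ) : Prop :=
  a₁.mulVec p + a₂.mulVec q = 0

theorem BoundaryCond.add {a₁ a₂ : Matrix (Fin n) (Fin n) ℝ} {p q p' q' : Fin n → ℝ}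
    (h : BoundaryCond a₁ a₂ p q) (h' : BoundaryCond a₁ a₂ p' q') :
    BoundaryCond a₁ a₂ (p + p') (q + q') := by
  unfold BoundaryCond at *
  rw [Matrix.mulVec_add, Matrix.mulVec_add, add_add_add_comm, h, h', add_zero]

theorem BoundaryCond.smul {a₁ a₂ : Matrix (Fin n) (Fin n) ℝ} (c : ℝ) {p q : Fin n → ℝ}
    (h : BoundaryCond a₁ a₂ p q) : BoundaryCond a₁ a₂ (c • p) (c • q) := by
  unfold BoundaryCond at *
  rw [Matrix.mulVec_smul, Matrix.mulVec_smul, ← smul_add, h, smul_zero]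

theorem BoundaryCond.zero (a₁ a₂ : Matrix (Fin n) (Fin n) ℝ) : BoundaryCond a₁ a₂ 0 0 := by
  simp [BoundaryCond]

/-- `L²((0, 1); ℝⁿ)`. -/
abbrev L2 (n : ℕ) : Type := Lp (Vec n) 2 (volume.restrict (Set.Icc (0 : ℝ) 1))

/-- The graph of the operator `H y = -y'' + V y` in `L²((0, 1); ℝⁿ)` with domain
`{y ∈ H²(0, 1) : α₁ y(0) + α₂ y'(0) = 0, β₁ y(1) + β₂ y'(1) = 0}`: the pairs `(f, h)` such that
`f` is represented by a function `y` in the domain and `h` by `-y'' + V y`. -/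
def schrodingerGraph (V : ℝ → Matrix (Fin n) (Fin n) ℝ)
    (α₁ α₂ β₁ β₂ : Matrix (Fin n) (Fin n) ℝ) : Submodule ℝ (L2 n × L2 n) where
  carrier := {fh | ∃ y y' y'' : ℝ → Vec n,
    HasWeakDeriv 1 y y' ∧ HasWeakDeriv 1 y' y'' ∧
    BoundaryCond α₁ α₂ (y 0) (y' 0) ∧ BoundaryCond β₁ β₂ (y 1) (y' 1) ∧
    (∀ᵐ x ∂(volume.restrict (Set.Icc (0 : ℝ) 1)), fh.1 x = y x) ∧
    (∀ᵐ x ∂(volume.restrict (Set.Icc (0 : ℝ) 1)),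
      fh.2 x = -y'' x + Matrix.toEuclideanCLM (𝕜 := ℝ) (V x) (y x))}
  add_mem' := by
    rintro f g ⟨y, y', y'', h1, h2, h3, h4, h5, h6⟩ ⟨z, z', z'', k1, k2, k3, k4, k5, k6⟩
    refine ⟨y + z, y' + z', y'' + z'', h1.add k1, h2.add k2, h3.add k3, h4.add k4, ?_, ?_⟩
    · filter_upwards [h5, k5, Lp.coeFn_add f.1 g.1] with x a b c
      rw [Prod.fst_add, c, Pi.add_apply, Pi.add_apply, a, b]
    · filter_upwards [h6, k6, Lp.coeFn_add f.2 g.2] with x a b c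
      rw [Prod.snd_add, c, Pi.add_apply, Pi.add_apply, Pi.add_apply, a, b, map_add]
      abel
  zero_mem' := by
    refine ⟨0, 0, 0, HasWeakDeriv.zero 1, HasWeakDeriv.zero 1, BoundaryCond.zero _ _,
      BoundaryCond.zero _ _, ?_, ?_⟩
    · filter_upwards [Lp.coeFn_zero (Vec n) 2 (volume.restrict (Set.Icc (0 : ℝ) 1))] with x a
      simpa using a
    · filter_upwards [Lp.coeFn_zero (Vec n) 2 (volume.restrict (Set.Icc (0 : ℝ) 1))] with x a
      simpa using a
  smul_mem' := by
    rintro c f ⟨y, y', y'', h1, h2, h3, h4, h5, h6⟩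
    refine ⟨c • y, c • y', c • y'', h1.smul c, h2.smul c, h3.smul c, h4.smul c, ?_, ?_⟩
    · filter_upwards [h5, Lp.coeFn_smul c f.1] with x a b
      rw [Prod.smul_fst, b, Pi.smul_apply, Pi.smul_apply, a]
    · filter_upwards [h6, Lp.coeFn_smul c f.2] with x a b
      rw [Prod.smul_snd, b, Pi.smul_apply, Pi.smul_apply, Pi.smul_apply, a, map_smul,
        smul_add, smul_neg]

/-- The eigenspace `{f : H f = μ f}` of `H`. -/
def eigenspaceH (V : ℝ → Matrix (Fin n) (Fin n) ℝ)
    (α₁ α₂ β₁ β₂ : Matrix (Fin n) (Fin n) ℝ) (μ : ℝ) : Submodule ℝ (L2 n) :=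
  (schrodingerGraph V α₁ α₂ β₁ β₂).comap
    (LinearMap.prod LinearMap.id (μ • LinearMap.id))

/-- The Morse index of `H`: the number of its negative eigenvalues, counted with
multiplicity. -/
def morseIndex (V : ℝ → Matrix (Fin n) (Fin n) ℝ)
    (α₁ α₂ β₁ β₂ : Matrix (Fin n) (Fin n) ℝ) : ℕ∞ :=
  ∑' μ : Set.Iio (0 : ℝ), Cardinal.toENat (Module.rank ℝ (eigenspaceH V α₁ α₂ β₁ β₂ μ))

/-! ### The Lagrangian subspaces of the boundary value problem -/

/-- The matrix of the first order system: blocks `0, I` (first row) and `V(x) - λ I, 0`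
(second row). -/
def systemMatrix (V : ℝ → Matrix (Fin n) (Fin n) ℝ) (lam x : ℝ) : PhaseMatrix n :=
  Matrix.fromBlocks 0 1 (V x - lam • 1) 0

/-- The space of the solutions `𝐩 = (p, q) ∈ H¹(0, s)` of `𝐩' = 𝔸(x; λ) 𝐩` which satisfy
`α₁ p(0) + α₂ q(0) = 0` (functions on `ℝ`, of which only the values on `[0, s]` matter). -/
def solutionSpace (V : ℝ → Matrix (Fin n) (Fin n) ℝ) (α₁ α₂ : Matrix (Fin n) (Fin n) ℝ)
    (s lam : ℝ) : Submodule ℝ (ℝ → PhaseSpace n) where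
  carrier := {p | ∃ p' : ℝ → PhaseSpace n, HasWeakDeriv s p p' ∧
    (∀ᵐ x ∂(volume.restrict (Set.Icc (0 : ℝ) s)),
      p' x = Matrix.toEuclideanCLM (𝕜 := ℝ) (systemMatrix V lam x) (p x)) ∧
    BoundaryCond α₁ α₂ (fun i => p 0 (Sum.inl i)) (fun i => p 0 (Sum.inr i))}
  add_mem' := by
    rintro p r ⟨p', h1, h2, h3⟩ ⟨r', k1, k2, k3⟩
    refine ⟨p' + r', h1.add k1, ?_, h3.add k3⟩
    filter_upwards [h2, k2] with x a b
    rw [Pi.add_apply, Pi.add_apply, a, b, map_add]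
  zero_mem' := by
    refine ⟨0, HasWeakDeriv.zero s, ?_, BoundaryCond.zero _ _⟩
    filter_upwards with x
    simp
  smul_mem' := by
    rintro c p ⟨p', h1, h2, h3⟩
    refine ⟨c • p', h1.smul c, ?_, h3.smul c⟩
    filter_upwards [h2] with x a
    rw [Pi.smul_apply, Pi.smul_apply, a, map_smul]

/-- The space `ℓ(s, λ)` of the traces `𝐩(s)` of these solutions. -/
def traceSpace (V : ℝ → Matrix (Fin n) (Fin n) ℝ) (α₁ α₂ : Matrix (Fin n) (Fin n) ℝ)
    (s lam : ℝ) : Submodule ℝ (PhaseSpace n) :=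
  (solutionSpace V α₁ α₂ s lam).map (LinearMap.proj s)

/-- The target `ℓ₁`: the vectors `(p, q)` with `β₁ p + β₂ q = 0`. -/
def targetSpace (β₁ β₂ : Matrix (Fin n) (Fin n) ℝ) : Submodule ℝ (PhaseSpace n) where
  carrier := {v | BoundaryCond β₁ β₂ (fun i => v (Sum.inl i)) (fun i => v (Sum.inr i))}
  add_mem' := fun h k => BoundaryCond.add h k
  zero_mem' := BoundaryCond.zero _ _
  smul_mem' := fun c _ h => BoundaryCond.smul c h

end MaslovMorse

end

open MaslovMorse

/-!
Write `exp(φ J) = cos φ + sin φ J`. The eigenspace of `W̃` at `e^{i(π + θ)}` has the complex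
dimension `dim (ℓ ∩ exp((θ/2) J) ℓ₁)`. If `e^{i(π + ε)}` is not an eigenvalue, then `ℓ` is the
graph, with respect to `ℝ²ⁿ = ℓ₁ ⊕ exp((ε/2) J) ℓ₁`, of a symmetric operator `N`, and since
`θ ↦ sin(θ/2) / sin(ε/2 - θ/2)` maps `[0, ε)` bijectively onto `[0, ∞)`, the count `k(ε)` is the
number of nonnegative eigenvalues of `N`.

Along `λ = -t` the operator `N` is strictly monotone: by the Lagrange identity the symplectic form
of the boundary values of two solutions for `λ` and `μ` is `λ - μ` times their `L²` inner product.
Hence `k(ε)` is constant immediately to the right of `t` and smaller by `dim (ℓ ∩ ℓ₁)`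
immediately to the left. So the Maslov index is the sum over `0 < t ≤ λ_∞` of
`dim (ℓ(1, -t) ∩ ℓ₁)`, the dimension of the eigenspace of `H` for the eigenvalue `-t`.
-/

noncomputable section

namespace MaslovMorse

variable {n : ℕ}

/-! ### Lagrangian subspaces and rotations -/

/-- The complex structure `J (p, q) = (-q, p)` of `ℝ²ⁿ`, as an operator. -/
def Jmap (n : ℕ) : PhaseSpace n →L[ℝ] PhaseSpace n := Matrix.toEuclideanCLM (𝕜 := ℝ) (symplJ n)

@[simp] theorem Jmap_inl (x : PhaseSpace n) (i : Fin n) :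
    Jmap n x (Sum.inl i) = -x (Sum.inr i) := by
  simp [Jmap, symplJ, Matrix.ofLp_toEuclideanCLM, Matrix.mulVec, dotProduct, Fintype.sum_sum_type,
    Matrix.one_apply]

@[simp] theorem Jmap_inr (x : PhaseSpace n) (i : Fin n) : Jmap n x (Sum.inr i) = x (Sum.inl i) := by
  simp [Jmap, symplJ, Matrix.ofLp_toEuclideanCLM, Matrix.mulVec, dotProduct, Fintype.sum_sum_type,
    Matrix.one_apply]

@[simp] theorem Jmap_Jmap (x : PhaseSpace n) : Jmap n (Jmap n x) = -x := by
  ext (i | i) <;> simp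

theorem Jmap_injective : Function.Injective (Jmap n) := by
  intro x y h
  simpa using congrArg (Jmap n) h

theorem omega_eq_inner (x y : PhaseSpace n) : omega x y = inner ℝ (Jmap n x) y := rfl

theorem inner_eq_sum (x y : PhaseSpace n) : inner ℝ x y =
    ∑ i, x (Sum.inl i) * y (Sum.inl i) + ∑ i, x (Sum.inr i) * y (Sum.inr i) := by
  simp [PiLp.inner_apply, Fintype.sum_sum_type, mul_comm]

theorem inner_Jmap_Jmap (x y : PhaseSpace n) :
    inner ℝ (Jmap n x) (Jmap n y) = inner ℝ x y := by
  simp [inner_eq_sum, add_comm]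

theorem inner_Jmap_left (x y : PhaseSpace n) :
    inner ℝ (Jmap n x) y = -inner ℝ x (Jmap n y) := by
  rw [← inner_Jmap_Jmap, Jmap_Jmap, inner_neg_left]

theorem omega_eq_sum (x y : PhaseSpace n) : omega x y =
    ∑ i, x (Sum.inl i) * y (Sum.inr i) - ∑ i, x (Sum.inr i) * y (Sum.inl i) := by
  rw [omega_eq_inner, inner_eq_sum]
  simp
  ring

/-- The rotation `exp(φ J) = cos φ + sin φ J`. -/
def rot (φ : ℝ) : PhaseSpace n →L[ℝ] PhaseSpace n := Real.cos φ • 1 + Real.sin φ • Jmap n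

theorem rot_apply (φ : ℝ) (x : PhaseSpace n) :
    rot φ x = Real.cos φ • x + Real.sin φ • Jmap n x := rfl

@[simp] theorem rot_zero (x : PhaseSpace n) : rot 0 x = x := by simp [rot_apply]

theorem rot_rot (φ ψ : ℝ) (x : PhaseSpace n) : rot φ (rot ψ x) = rot (φ + ψ) x := by
  simp only [rot_apply, map_add, map_smul, Jmap_Jmap, Real.cos_add, Real.sin_add]
  module

theorem rot_Jmap (φ : ℝ) (x : PhaseSpace n) : rot φ (Jmap n x) = Jmap n (rot φ x) := by
  simp only [rot_apply, map_add, map_smul]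

theorem inner_rot_rot (φ : ℝ) (x y : PhaseSpace n) :
    inner ℝ (rot φ x) (rot φ y) = inner ℝ x y := by
  simp only [rot_apply, inner_add_left, inner_add_right, inner_smul_left, inner_smul_right,
    inner_Jmap_Jmap, inner_Jmap_left x y]
  have := Real.sin_sq_add_cos_sq φ
  simp only [conj_trivial]
  linear_combination (inner ℝ x y) * this

theorem IsLagrangian.Jmap_mem_orthogonal {l : Submodule ℝ (PhaseSpace n)} (hl : IsLagrangian l)
    {x : PhaseSpace n} (hx : x ∈ l) : Jmap n x ∈ lᗮ := by
  rw [Submodule.mem_orthogonal']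
  exact fun y hy => hl.2 x hx y hy

theorem IsLagrangian.map_Jmap {l : Submodule ℝ (PhaseSpace n)} (hl : IsLagrangian l) :
    l.map (Jmap n : PhaseSpace n →ₗ[ℝ] PhaseSpace n) = lᗮ := by
  apply Submodule.eq_of_le_of_finrank_eq
  · rintro _ ⟨x, hx, rfl⟩
    exact hl.Jmap_mem_orthogonal hx
  · have hperp := l.finrank_add_finrank_orthogonal
    have hmap := (Submodule.equivMapOfInjective (Jmap n : PhaseSpace n →ₗ[ℝ] PhaseSpace n)
      Jmap_injective l).finrank_eq
    rw [finrank_euclideanSpace, Fintype.card_sum, Fintype.card_fin, hl.1] at hperp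
    rw [← hmap, hl.1]
    omega

theorem IsLagrangian.Jmap_mem {l : Submodule ℝ (PhaseSpace n)} (hl : IsLagrangian l)
    {x : PhaseSpace n} (hx : x ∈ lᗮ) : Jmap n x ∈ l := by
  rw [← hl.map_Jmap] at hx
  obtain ⟨y, hy, rfl⟩ := hx
  simpa using hy

theorem IsLagrangian.starProjection_Jmap {l : Submodule ℝ (PhaseSpace n)} (hl : IsLagrangian l)
    (x : PhaseSpace n) :
    l.starProjection (Jmap n x) = Jmap n (x - l.starProjection x) := by
  apply Submodule.eq_starProjection_of_mem_orthogonal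
  · exact hl.Jmap_mem (Submodule.sub_starProjection_mem_orthogonal x)
  · rw [← map_sub, sub_sub_cancel]
    exact hl.Jmap_mem_orthogonal (Submodule.starProjection_apply_mem _ _)

theorem IsLagrangian.reflection_Jmap {l : Submodule ℝ (PhaseSpace n)} (hl : IsLagrangian l)
    (x : PhaseSpace n) : l.reflection (Jmap n x) = -Jmap n (l.reflection x) := by
  rw [Submodule.reflection_apply, Submodule.reflection_apply, hl.starProjection_Jmap]
  simp only [map_sub, map_nsmul]
  module

theorem IsLagrangian.reflection_rot {l : Submodule ℝ (PhaseSpace n)} (hl : IsLagrangian l)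
    (φ : ℝ) (x : PhaseSpace n) : l.reflection (rot φ x) = rot (-φ) (l.reflection x) := by
  simp only [rot_apply, map_add, map_smul, hl.reflection_Jmap, Real.cos_neg, Real.sin_neg]
  module

/-- The image of a subspace under `exp(φ J)`. -/
def rotate (φ : ℝ) (l : Submodule ℝ (PhaseSpace n)) : Submodule ℝ (PhaseSpace n) :=
  l.map (rot (n := n) φ : PhaseSpace n →ₗ[ℝ] PhaseSpace n)

theorem mem_rotate {l : Submodule ℝ (PhaseSpace n)} {φ : ℝ} {x : PhaseSpace n} :
    x ∈ rotate φ l ↔ rot (-φ) x ∈ l := by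
  constructor
  · rintro ⟨y, hy, rfl⟩
    simpa [rot_rot] using hy
  · intro h
    exact ⟨_, h, by simp [rot_rot]⟩

theorem IsLagrangian.mem_rotate_iff {l : Submodule ℝ (PhaseSpace n)} (hl : IsLagrangian l)
    {φ : ℝ} {x : PhaseSpace n} :
    x ∈ rotate φ l ↔
      l.reflection x = rot (-(2 * φ)) x := by
  rw [mem_rotate, ← Submodule.reflection_eq_self_iff, hl.reflection_rot, neg_neg]
  constructor
  · intro h
    have := congrArg (rot (-φ)) h
    rw [rot_rot, rot_rot] at this
    simpa [two_mul] using this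
  · intro h
    rw [h, rot_rot]
    congr 2
    ring_nf

theorem IsLagrangian.finrank_eq_two_mul_finrank_inf {l E : Submodule ℝ (PhaseSpace n)}
    (hl : IsLagrangian l) (hJ : ∀ x ∈ E, Jmap n x ∈ E) (hr : ∀ x ∈ E, l.reflection x ∈ E) :
    Module.finrank ℝ E = 2 * Module.finrank ℝ (E ⊓ l : Submodule ℝ (PhaseSpace n)) := by
  have hproj : ∀ x ∈ E, l.starProjection x ∈ E := fun x hx => by
    have h : l.starProjection x = (2⁻¹ : ℝ) • (l.reflection x + x) := by
      rw [Submodule.reflection_apply]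
      module
    rw [h]
    exact E.smul_mem _ (E.add_mem (hr x hx) hx)
  have hmap : (E ⊓ l).map (Jmap n : PhaseSpace n →ₗ[ℝ] PhaseSpace n) = E ⊓ lᗮ := by
    ext x
    constructor
    · rintro ⟨y, hy, rfl⟩
      exact ⟨hJ y hy.1, hl.Jmap_mem_orthogonal hy.2⟩
    · intro hx
      exact ⟨-Jmap n x, ⟨neg_mem (hJ x hx.1), neg_mem (hl.Jmap_mem hx.2)⟩, by simp⟩
  have hsup : (E ⊓ l) ⊔ (E ⊓ lᗮ) = E := by
    refine le_antisymm (sup_le inf_le_left inf_le_left) fun x hx => ?_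
    exact Submodule.mem_sup.2 ⟨_, ⟨hproj x hx, Submodule.starProjection_apply_mem l x⟩, _,
      ⟨E.sub_mem hx (hproj x hx), Submodule.sub_starProjection_mem_orthogonal x⟩,
      add_sub_cancel _ _⟩
  have hinf : (E ⊓ l) ⊓ (E ⊓ lᗮ) = ⊥ :=
    (l.orthogonal_disjoint.mono inf_le_right inf_le_right).eq_bot
  have hJfin := (Submodule.equivMapOfInjective (Jmap n : PhaseSpace n →ₗ[ℝ] PhaseSpace n)
    Jmap_injective (E ⊓ l)).finrank_eq
  have hadd := Submodule.finrank_sup_add_finrank_inf_eq (E ⊓ l) (E ⊓ lᗮ)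
  rw [hsup, hinf, finrank_bot, ← hmap] at hadd
  omega

/-! ### The eigenspaces of `W̃` -/

theorem toEuclideanCLM_projMatrix (l : Submodule ℝ (PhaseSpace n)) :
    Matrix.toEuclideanCLM (𝕜 := ℝ) (projMatrix l) = l.starProjection := by
  rw [projMatrix, StarAlgEquiv.apply_symm_apply]

theorem toEuclideanCLM_wMatrix (l l₁ : Submodule ℝ (PhaseSpace n)) (x : PhaseSpace n) :
    Matrix.toEuclideanCLM (𝕜 := ℝ) (wMatrix l l₁) x = -l.reflection (l₁.reflection x) := by
  have h2 : ∀ A : PhaseMatrix n, ∀ x, Matrix.toEuclideanCLM (𝕜 := ℝ) (2 * A) x =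
      2 • Matrix.toEuclideanCLM (𝕜 := ℝ) A x := by
    intro A x
    rw [two_mul, map_add, two_smul, add_apply]
  rw [wMatrix, conjMatrix, map_mul, mul_apply_eq_comp, map_sub, map_sub, map_one, sub_apply,
    sub_apply, one_apply_eq_self, one_apply_eq_self, h2, h2, toEuclideanCLM_projMatrix,
    toEuclideanCLM_projMatrix, Submodule.reflection_apply, Submodule.reflection_apply]
  abel

/-- The identification `(p, q) ↦ p + i q` of `ℝ²ⁿ` with `ℂⁿ`. -/
def toComplexVec (n : ℕ) : PhaseSpace n ≃ₗ[ℝ] (Fin n → ℂ) where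
  toFun x := fun i => ⟨x (Sum.inl i), x (Sum.inr i)⟩
  invFun z := WithLp.toLp 2 (Sum.elim (fun i => (z i).re) (fun i => (z i).im))
  map_add' x y := by ext i; apply Complex.ext <;> simp
  map_smul' c x := by ext i; apply Complex.ext <;> simp
  left_inv x := by ext (i | i) <;> simp
  right_inv z := by ext i; simp

theorem toComplexVec_Jmap (x : PhaseSpace n) :
    toComplexVec n (Jmap n x) = Complex.I • toComplexVec n x := by
  ext i
  apply Complex.ext <;> simp [toComplexVec]

theorem toComplexVec_rot (φ : ℝ) (x : PhaseSpace n) :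
    toComplexVec n (rot φ x) = Complex.exp (Complex.I * (φ : ℂ)) • toComplexVec n x := by
  rw [rot_apply, map_add, map_smul, map_smul, toComplexVec_Jmap, mul_comm Complex.I,
    Complex.exp_mul_I, ← Complex.ofReal_cos, ← Complex.ofReal_sin]
  ext i
  simp
  ring

theorem blocks_of_commute_Jmap {W : PhaseMatrix n}
    (hW : ∀ x, Matrix.toEuclideanCLM (𝕜 := ℝ) W (Jmap n x) =
      Jmap n (Matrix.toEuclideanCLM (𝕜 := ℝ) W x)) (i j : Fin n) :
    W (Sum.inl i) (Sum.inr j) = -W (Sum.inr i) (Sum.inl j) ∧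
      W (Sum.inr i) (Sum.inr j) = W (Sum.inl i) (Sum.inl j) := by
  have h := hW (EuclideanSpace.single (Sum.inl j) 1)
  have hJ : Jmap n (EuclideanSpace.single (Sum.inl j) (1 : ℝ)) =
      EuclideanSpace.single (Sum.inr j) (1 : ℝ) := by
    ext (k | k) <;> simp
  rw [hJ] at h
  constructor
  · simpa [Matrix.ofLp_toEuclideanCLM] using congrArg (fun v : PhaseSpace n => v (Sum.inl i)) h
  · simpa [Matrix.ofLp_toEuclideanCLM] using congrArg (fun v : PhaseSpace n => v (Sum.inr i)) h

theorem complexMatrix_mulVec {W : PhaseMatrix n}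
    (hW : ∀ x, Matrix.toEuclideanCLM (𝕜 := ℝ) W (Jmap n x) =
      Jmap n (Matrix.toEuclideanCLM (𝕜 := ℝ) W x)) (x : PhaseSpace n) :
    (complexMatrix W).mulVec (toComplexVec n x) =
      toComplexVec n (Matrix.toEuclideanCLM (𝕜 := ℝ) W x) := by
  ext i
  apply Complex.ext
  · simp [complexMatrix, toComplexVec, Matrix.toBlocks₁₁, Matrix.toBlocks₂₁,
      Matrix.ofLp_toEuclideanCLM, Matrix.mulVec, dotProduct, Fintype.sum_sum_type,
      blocks_of_commute_Jmap hW, sub_eq_add_neg, Finset.sum_add_distrib]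
  · simp [complexMatrix, toComplexVec, Matrix.toBlocks₁₁, Matrix.toBlocks₂₁,
      Matrix.ofLp_toEuclideanCLM, Matrix.mulVec, dotProduct, Fintype.sum_sum_type,
      blocks_of_commute_Jmap hW, Finset.sum_add_distrib, add_comm]

theorem mem_circleEigenspace_wTilde {l l₁ : Submodule ℝ (PhaseSpace n)} (hl : IsLagrangian l)
    (hl₁ : IsLagrangian l₁) (θ : ℝ) (x : PhaseSpace n) :
    toComplexVec n x ∈ circleEigenspace (wTilde l l₁) θ ↔
      l.reflection (l₁.reflection x) = rot θ x := by
  have hW : ∀ x, Matrix.toEuclideanCLM (𝕜 := ℝ) (wMatrix l l₁) (Jmap n x) =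
      Jmap n (Matrix.toEuclideanCLM (𝕜 := ℝ) (wMatrix l l₁) x) := by
    intro x
    simp only [toEuclideanCLM_wMatrix, hl₁.reflection_Jmap, map_neg, hl.reflection_Jmap, neg_neg]
  have hr : rot (Real.pi + θ) x = -rot θ x := by
    rw [rot_apply, rot_apply, add_comm Real.pi, Real.cos_add_pi, Real.sin_add_pi]
    module
  rw [circleEigenspace, Module.End.mem_eigenspace_iff, Matrix.toLin'_apply, wTilde,
    complexMatrix_mulVec hW, ← toComplexVec_rot, (toComplexVec n).injective.eq_iff,
    toEuclideanCLM_wMatrix, hr, neg_inj]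

theorem IsLagrangian.reflection_reflection_reflection_eq_rot {l l₁ : Submodule ℝ (PhaseSpace n)}
    (hl : IsLagrangian l) (hl₁ : IsLagrangian l₁) {θ : ℝ} {x : PhaseSpace n}
    (hx : l.reflection (l₁.reflection x) = rot θ x) :
    l.reflection (l₁.reflection (l.reflection x)) = rot θ (l.reflection x) := by
  have h₁ : l₁.reflection x = rot (-θ) (l.reflection x) := by
    rw [← hl.reflection_rot, ← hx, Submodule.reflection_reflection]
  have h : l.reflection x = rot θ (l₁.reflection x) := by simp [h₁, rot_rot]
  nth_rewrite 1 [h]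
  rw [hl₁.reflection_rot, Submodule.reflection_reflection, hl.reflection_rot, neg_neg]

theorem finrank_circleEigenspace {l l₁ : Submodule ℝ (PhaseSpace n)} (hl : IsLagrangian l)
    (hl₁ : IsLagrangian l₁) (θ : ℝ) :
    Module.finrank ℂ (circleEigenspace (wTilde l l₁) θ) =
      Module.finrank ℝ (l ⊓ rotate (θ / 2) l₁ : Submodule ℝ (PhaseSpace n)) := by
  set X := circleEigenspace (wTilde l l₁) θ
  set E := (X.restrictScalars ℝ).map (toComplexVec n).symm.toLinearMap with hE
  have mem_E : ∀ x, x ∈ E ↔ l.reflection (l₁.reflection x) = rot θ x := fun x => by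
    rw [← mem_circleEigenspace_wTilde hl hl₁, hE, Submodule.map_equiv_eq_comap_symm]
    rfl
  have hinf : E ⊓ l = l ⊓ rotate (θ / 2) l₁ := by
    ext x
    rw [inf_comm E l, Submodule.mem_inf, Submodule.mem_inf, mem_E]
    refine and_congr_right fun hx => ?_
    rw [hl₁.mem_rotate_iff, mul_div_cancel₀ θ two_ne_zero, ← l.reflection.injective.eq_iff,
      Submodule.reflection_reflection, hl.reflection_rot, l.reflection_eq_self_iff x |>.2 hx]
  have hfin : Module.finrank ℝ E = 2 * Module.finrank ℂ X := by
    rw [hE, LinearEquiv.finrank_map_eq]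
    exact finrank_real_of_complex X
  have h := hl.finrank_eq_two_mul_finrank_inf (E := E) (fun x hx => ?_) (fun x hx => ?_)
  · rw [hinf] at h
    omega
  · rw [mem_E] at hx ⊢
    rw [hl₁.reflection_Jmap, map_neg, hl.reflection_Jmap, hx, neg_neg, rot_Jmap]
  · rw [mem_E] at hx ⊢
    exact hl.reflection_reflection_reflection_eq_rot hl₁ hx

/-! ### Inertia of symmetric operators -/

open Filter Topology in
theorem eventually_forall_mem_pos {X E : Type*} [TopologicalSpace X] [NormedAddCommGroup E]
    [NormedSpace ℝ E] [FiniteDimensional ℝ E] {q : X → E → ℝ} {x₀ : X}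
    (hq : ∀ a, ContinuousAt (fun z : X × E => q z.1 z.2) (x₀, a))
    (hsmul : ∀ x (c : ℝ) a, q x (c • a) = c ^ 2 * q x a) {P : Submodule ℝ E}
    (hpos : ∀ a ∈ P, a ≠ 0 → 0 < q x₀ a) :
    ∀ᶠ x in 𝓝 x₀, ∀ a ∈ P, a ≠ 0 → 0 < q x a := by
  have hK : IsCompact (Metric.sphere (0 : E) 1 ∩ P) :=
    (isCompact_sphere 0 1).inter_right P.closed_of_finiteDimensional
  have hsphere : ∀ᶠ x in 𝓝 x₀, ∀ a ∈ Metric.sphere (0 : E) 1 ∩ P, 0 < q x a :=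
    hK.eventually_forall_of_forall_eventually fun a ha =>
      (hq a).eventually_const_lt
        (hpos a ha.2 (norm_ne_zero_iff.1 (by rw [mem_sphere_zero_iff_norm.1 ha.1]; simp)))
  filter_upwards [hsphere] with x hx a ha h0
  have hnorm : ‖a‖ ≠ 0 := norm_ne_zero_iff.2 h0
  have hunit := hx (‖a‖⁻¹ • a) ⟨by simp [norm_smul, hnorm], P.smul_mem _ ha⟩
  rw [hsmul] at hunit
  exact pos_of_mul_pos_right hunit (sq_nonneg _)

section Inertia

variable {E : Type*} [NormedAddCommGroup E] [InnerProductSpace ℝ E] [FiniteDimensional ℝ E]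

theorem inner_apply_eq_sum_eigenvalues {T : E →ₗ[ℝ] E} (hT : T.IsSymmetric) (x : E) :
    inner ℝ (T x) x =
      ∑ i, hT.eigenvalues rfl i * (inner ℝ (hT.eigenvectorBasis rfl i) x) ^ 2 := by
  rw [← (hT.eigenvectorBasis rfl).sum_inner_mul_inner]
  refine Finset.sum_congr rfl fun i _ => ?_
  rw [hT x, hT.apply_eigenvectorBasis, inner_smul_right, real_inner_comm]
  simp only [RCLike.ofReal_real_eq_id, id_eq]
  ring

/-- The sum of the eigenspaces of a symmetric operator for the eigenvalues in `s`, spanned here by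
the members of an eigenbasis. -/
def spectralSubspace {T : E →ₗ[ℝ] E} (hT : T.IsSymmetric) (s : Set ℝ) : Submodule ℝ E :=
  Submodule.span ℝ (hT.eigenvectorBasis rfl '' {i | hT.eigenvalues rfl i ∈ s})

namespace spectralSubspace

variable {T : E →ₗ[ℝ] E} (hT : T.IsSymmetric)

theorem finrank_eq_ncard (s : Set ℝ) :
    Module.finrank ℝ (spectralSubspace hT s) = {i | hT.eigenvalues rfl i ∈ s}.ncard := by
  have hb := (hT.eigenvectorBasis rfl).orthonormal.linearIndependent
  classical
  rw [spectralSubspace, Set.image_eq_range, ← Nat.card_coe_set_eq, Nat.card_eq_fintype_card]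
  exact finrank_span_eq_card (hb.comp _ Subtype.val_injective)

theorem finrank_union {s t : Set ℝ} (hst : Disjoint s t) :
    Module.finrank ℝ (spectralSubspace hT (s ∪ t)) =
      Module.finrank ℝ (spectralSubspace hT s) + Module.finrank ℝ (spectralSubspace hT t) := by
  simp only [finrank_eq_ncard]
  exact Set.ncard_union_eq (hst.preimage _)

theorem finrank_add_finrank_compl (s : Set ℝ) :
    Module.finrank ℝ (spectralSubspace hT s) + Module.finrank ℝ (spectralSubspace hT sᶜ) =
      Module.finrank ℝ E := by
  rw [← finrank_union hT disjoint_compl_right, Set.union_compl_self, finrank_eq_ncard]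
  simp

theorem finrank_eigenspace (κ : ℝ) :
    Module.finrank ℝ (Module.End.eigenspace T κ) =
      Module.finrank ℝ (spectralSubspace hT {κ}) := by
  rw [finrank_eq_ncard, ← hT.card_filter_eigenvalues_eq rfl κ, ← Set.ncard_coe_finset]
  simp

theorem finrank_eq_finsum (s : Set ℝ) :
    Module.finrank ℝ (spectralSubspace hT s) =
      ∑ᶠ κ ∈ s, Module.finrank ℝ (Module.End.eigenspace T κ) := by
  classical
  set e := hT.eigenvalues rfl
  set t := Finset.univ.filter fun i => e i ∈ s
  have hcard : ∀ κ : ℝ, Module.finrank ℝ (Module.End.eigenspace T κ) =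
      (Finset.univ.filter fun i => e i = κ).card := fun κ =>
    (hT.card_filter_eigenvalues_eq rfl κ).symm
  have ht : Module.finrank ℝ (spectralSubspace hT s) = t.card := by
    rw [finrank_eq_ncard, ← Set.ncard_coe_finset]
    simp [t, e]
  rw [ht, finsum_mem_eq_sum_of_subset (t := t.image e), Finset.card_eq_sum_card_image e t]
  · refine Finset.sum_congr rfl fun κ hκ => ?_
    obtain ⟨j, hj, rfl⟩ := Finset.mem_image.1 hκ
    rw [hcard, Finset.filter_filter]
    congr 1
    refine Finset.filter_congr fun i _ => and_iff_right_of_imp fun h => ?_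
    rw [h]
    exact (Finset.mem_filter.1 hj).2
  · rintro κ ⟨hκ, hne⟩
    rw [Function.mem_support, hcard] at hne
    obtain ⟨i, hi⟩ := Finset.card_ne_zero.1 hne
    obtain rfl := (Finset.mem_filter.1 hi).2
    exact Finset.mem_coe.2 (Finset.mem_image_of_mem e (by simpa [t] using hκ))
  · intro κ hκ
    obtain ⟨j, hj, rfl⟩ := Finset.mem_image.1 hκ
    exact (Finset.mem_filter.1 hj).2

variable {hT} {s : Set ℝ} {x : E}

theorem inner_eigenvectorBasis_eq_zero (hx : x ∈ spectralSubspace hT s)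
    {i : Fin (Module.finrank ℝ E)} (hi : hT.eigenvalues rfl i ∉ s) :
    inner ℝ (hT.eigenvectorBasis rfl i) x = 0 := by
  induction hx using Submodule.span_induction with
  | mem x h =>
    obtain ⟨j, hj, rfl⟩ := h
    exact (hT.eigenvectorBasis rfl).orthonormal.2 fun h => hi (h ▸ hj)
  | zero => exact inner_zero_right _
  | add x y _ _ hx hy => rw [inner_add_right, hx, hy, add_zero]
  | smul a x _ h => rw [inner_smul_right, h, mul_zero]

theorem exists_inner_eigenvectorBasis_ne_zero (hx : x ∈ spectralSubspace hT s) (h0 : x ≠ 0) :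
    ∃ i, hT.eigenvalues rfl i ∈ s ∧ inner ℝ (hT.eigenvectorBasis rfl i) x ≠ 0 := by
  by_contra! h
  refine h0 (InnerProductSpace.ext_inner_left_basis (hT.eigenvectorBasis rfl).toBasis fun i => ?_)
  rw [OrthonormalBasis.coe_toBasis, inner_zero_right]
  by_cases hi : hT.eigenvalues rfl i ∈ s
  · exact h i hi
  · exact inner_eigenvectorBasis_eq_zero hx hi

theorem inner_apply_eq_sum [DecidablePred fun i => hT.eigenvalues rfl i ∈ s]
    (hx : x ∈ spectralSubspace hT s) :
    inner ℝ (T x) x = ∑ i with hT.eigenvalues rfl i ∈ s,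
      hT.eigenvalues rfl i * (inner ℝ (hT.eigenvectorBasis rfl i) x) ^ 2 := by
  rw [inner_apply_eq_sum_eigenvalues hT, Finset.sum_filter_of_ne]
  intro i _ h
  by_contra hi
  rw [inner_eigenvectorBasis_eq_zero hx hi, sq, mul_zero, mul_zero] at h
  exact h rfl

theorem inner_apply_nonneg (hs : ∀ κ ∈ s, 0 ≤ κ) (hx : x ∈ spectralSubspace hT s) :
    0 ≤ inner ℝ (T x) x := by
  classical
  rw [inner_apply_eq_sum hx]
  exact Finset.sum_nonneg fun i hi =>
    mul_nonneg (hs _ (Finset.mem_filter.1 hi).2) (sq_nonneg _)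

theorem inner_apply_nonpos (hs : ∀ κ ∈ s, κ ≤ 0) (hx : x ∈ spectralSubspace hT s) :
    inner ℝ (T x) x ≤ 0 := by
  classical
  rw [inner_apply_eq_sum hx]
  exact Finset.sum_nonpos fun i hi =>
    mul_nonpos_of_nonpos_of_nonneg (hs _ (Finset.mem_filter.1 hi).2) (sq_nonneg _)

theorem inner_apply_pos (hs : ∀ κ ∈ s, 0 < κ) (hx : x ∈ spectralSubspace hT s) (h0 : x ≠ 0) :
    0 < inner ℝ (T x) x := by
  obtain ⟨j, hj, hne⟩ := exists_inner_eigenvectorBasis_ne_zero hx h0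
  classical
  rw [inner_apply_eq_sum hx]
  refine Finset.sum_pos' (fun i hi => ?_) ⟨j, by simpa using hj, ?_⟩
  · exact mul_nonneg (hs _ (Finset.mem_filter.1 hi).2).le (sq_nonneg _)
  · exact mul_pos (hs _ hj) (pow_two_pos_of_ne_zero hne)

theorem inner_apply_neg (hs : ∀ κ ∈ s, κ < 0) (hx : x ∈ spectralSubspace hT s) (h0 : x ≠ 0) :
    inner ℝ (T x) x < 0 := by
  obtain ⟨j, hj, hne⟩ := exists_inner_eigenvectorBasis_ne_zero hx h0
  classical
  rw [inner_apply_eq_sum hx]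
  refine Finset.sum_neg' (fun i hi => ?_) ⟨j, by simpa using hj, ?_⟩
  · exact mul_nonpos_of_nonpos_of_nonneg (hs _ (Finset.mem_filter.1 hi).2).le (sq_nonneg _)
  · exact mul_neg_of_neg_of_pos (hs _ hj) (pow_two_pos_of_ne_zero hne)

theorem finrank_le_of_disjoint {T' : E →ₗ[ℝ] E} {hT' : T'.IsSymmetric} {s' : Set ℝ}
    (h : Disjoint (spectralSubspace hT s) (spectralSubspace hT' s'ᶜ)) :
    Module.finrank ℝ (spectralSubspace hT s) ≤ Module.finrank ℝ (spectralSubspace hT' s') := by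
  have hdisj := Submodule.finrank_add_finrank_le_of_disjoint h
  have hcompl := finrank_add_finrank_compl hT' s'
  omega

end spectralSubspace

/-- The number, with multiplicity, of the nonnegative eigenvalues of an operator. -/
def nonnegCount (T : E →L[ℝ] E) : ℕ :=
  ∑ᶠ κ ∈ Set.Ici (0 : ℝ), Module.finrank ℝ (Module.End.eigenspace (T : E →ₗ[ℝ] E) κ)

theorem nonnegCount_eq_finrank {T : E →L[ℝ] E} (hT : (T : E →ₗ[ℝ] E).IsSymmetric) :
    nonnegCount T = Module.finrank ℝ (spectralSubspace hT (Set.Ici 0)) :=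
  (spectralSubspace.finrank_eq_finsum hT _).symm

theorem nonnegCount_eq_finrank_ker_add {T : E →L[ℝ] E} (hT : (T : E →ₗ[ℝ] E).IsSymmetric) :
    nonnegCount T = Module.finrank ℝ (LinearMap.ker (T : E →ₗ[ℝ] E)) +
      Module.finrank ℝ (spectralSubspace hT (Set.Ioi 0)) := by
  rw [nonnegCount_eq_finrank hT, ← Module.End.eigenspace_zero,
    spectralSubspace.finrank_eigenspace hT, ← spectralSubspace.finrank_union hT (by simp),
    Set.singleton_union, Set.Ioi_insert]

open Filter Topology

theorem eventually_inner_apply_pos {T : E →L[ℝ] E} {P : Submodule ℝ E}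
    (hT : ∀ x ∈ P, x ≠ 0 → 0 < inner ℝ (T x) x) :
    ∀ᶠ T' in 𝓝 T, ∀ x ∈ P, x ≠ 0 → 0 < inner ℝ (T' x) x :=
  eventually_forall_mem_pos (q := fun (T : E →L[ℝ] E) x => inner ℝ (T x) x)
    (fun _ => Continuous.continuousAt (by fun_prop))
    (fun T c x => by simp only [map_smul, inner_smul_left, inner_smul_right]; simp; ring) hT

theorem eventually_inner_apply_neg {T : E →L[ℝ] E} {P : Submodule ℝ E}
    (hT : ∀ x ∈ P, x ≠ 0 → inner ℝ (T x) x < 0) :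
    ∀ᶠ T' in 𝓝 T, ∀ x ∈ P, x ≠ 0 → inner ℝ (T' x) x < 0 := by
  have h := eventually_inner_apply_pos (T := -T) (P := P) (by simpa using hT)
  simpa using (continuous_neg.tendsto T).eventually h

theorem eventually_nonnegCount_eq_of_lt {T : E →L[ℝ] E} (hT : (T : E →ₗ[ℝ] E).IsSymmetric) :
    ∀ᶠ T' : E →L[ℝ] E in 𝓝 T, (T' : E →ₗ[ℝ] E).IsSymmetric →
      (∀ x ≠ 0, inner ℝ (T x) x < inner ℝ (T' x) x) → nonnegCount T' = nonnegCount T := by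
  filter_upwards [eventually_inner_apply_neg (T := T)
    (P := spectralSubspace hT (Set.Iio 0)) fun x hx h0 =>
      spectralSubspace.inner_apply_neg (fun _ h => h) hx h0] with T' hneg hT' hlt
  rw [nonnegCount_eq_finrank hT, nonnegCount_eq_finrank hT']
  apply le_antisymm <;> refine spectralSubspace.finrank_le_of_disjoint
    (Submodule.disjoint_def.2 fun x hx hx' => ?_) <;> by_contra h0 <;> rw [Set.compl_Ici] at hx'
  · exact (spectralSubspace.inner_apply_nonneg (fun _ h => h) hx).not_gt (hneg x hx' h0)
  · exact ((spectralSubspace.inner_apply_nonneg (fun _ h => h) hx).trans_lt (hlt x h0)).not_gt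
      (spectralSubspace.inner_apply_neg (fun _ h => h) hx' h0)

theorem eventually_nonnegCount_add_finrank_ker_of_lt {T : E →L[ℝ] E}
    (hT : (T : E →ₗ[ℝ] E).IsSymmetric) :
    ∀ᶠ T' : E →L[ℝ] E in 𝓝 T, (T' : E →ₗ[ℝ] E).IsSymmetric →
      (∀ x ≠ 0, inner ℝ (T' x) x < inner ℝ (T x) x) →
      nonnegCount T' + Module.finrank ℝ (LinearMap.ker (T : E →ₗ[ℝ] E)) = nonnegCount T := by
  filter_upwards [eventually_inner_apply_pos (T := T)
    (P := spectralSubspace hT (Set.Ioi 0)) fun x hx h0 =>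
      spectralSubspace.inner_apply_pos (fun _ h => h) hx h0] with T' hpos hT' hlt
  rw [nonnegCount_eq_finrank_ker_add hT, nonnegCount_eq_finrank hT', add_comm,
    Nat.add_left_cancel_iff]
  apply le_antisymm <;> refine spectralSubspace.finrank_le_of_disjoint
    (Submodule.disjoint_def.2 fun x hx hx' => ?_) <;> by_contra h0
  · rw [Set.compl_Ioi] at hx'
    exact ((spectralSubspace.inner_apply_nonneg (fun _ h => h) hx).trans_lt (hlt x h0)).not_ge
      (spectralSubspace.inner_apply_nonpos (fun _ h => h) hx')
  · rw [Set.compl_Ici] at hx'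
    exact (hpos x hx h0).not_gt (spectralSubspace.inner_apply_neg (fun _ h => h) hx' h0)

end Inertia

/-! ### Lagrangian subspaces as graphs -/

theorem sin_smul_rot (φ ψ : ℝ) (x : PhaseSpace n) :
    Real.sin φ • rot ψ x = Real.sin (φ - ψ) • x + Real.sin ψ • rot φ x := by
  rw [rot_apply, rot_apply, Real.sin_sub]
  module

theorem rotate_zero (l : Submodule ℝ (PhaseSpace n)) : rotate 0 l = l := by
  ext x
  simp [mem_rotate]

theorem circleEigenspace_wTilde_eq_bot_iff {l l₁ : Submodule ℝ (PhaseSpace n)}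
    (hl : IsLagrangian l) (hl₁ : IsLagrangian l₁) (θ : ℝ) :
    circleEigenspace (wTilde l l₁) θ = ⊥ ↔ Disjoint l (rotate (θ / 2) l₁) := by
  rw [disjoint_iff, ← Submodule.finrank_eq_zero (R := ℂ), ← Submodule.finrank_eq_zero (R := ℝ),
    finrank_circleEigenspace hl hl₁]

section Graph

variable (l₁ : Submodule ℝ (PhaseSpace n)) (φ : ℝ)

/-- For a Lagrangian `l₁`, the component `b` in the decomposition `v = a + rot φ b` of `ℝ²ⁿ` into
`l₁` and its rotation. -/
def graphSnd : PhaseSpace n →L[ℝ] l₁ :=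
  -((Real.sin φ)⁻¹ • (l₁.orthogonalProjectionOnto ∘L Jmap n))

/-- For a Lagrangian `l₁`, the component `a` in the decomposition `v = a + rot φ b` of `ℝ²ⁿ` into
`l₁` and its rotation. -/
def graphFst : PhaseSpace n →L[ℝ] l₁ :=
  l₁.orthogonalProjectionOnto - Real.cos φ • graphSnd l₁ φ

variable {l₁ φ}

theorem graphSnd_apply (hl₁ : IsLagrangian l₁) (hφ : Real.sin φ ≠ 0) (a b : l₁) :
    graphSnd l₁ φ (a + rot φ (b : PhaseSpace n)) = b := by
  simp only [graphSnd, rot_apply, neg_apply, smul_apply, ContinuousLinearMap.comp_apply, map_add,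
    map_smul, Jmap_Jmap, map_neg, Submodule.orthogonalProjectionOnto_mem_subspace_eq_self,
    Submodule.orthogonalProjectionOnto_apply_of_mem_orthogonal
      (hl₁.Jmap_mem_orthogonal (Subtype.prop _))]
  match_scalars
  field_simp

theorem graphFst_apply (hl₁ : IsLagrangian l₁) (hφ : Real.sin φ ≠ 0) (a b : l₁) :
    graphFst l₁ φ (a + rot φ (b : PhaseSpace n)) = a := by
  rw [graphFst, sub_apply, smul_apply, graphSnd_apply hl₁ hφ]
  simp only [rot_apply, map_add, map_smul, Submodule.orthogonalProjectionOnto_mem_subspace_eq_self,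
    Submodule.orthogonalProjectionOnto_apply_of_mem_orthogonal
      (hl₁.Jmap_mem_orthogonal (Subtype.prop _))]
  module

theorem graphFst_add_rot_graphSnd (hl₁ : IsLagrangian l₁) (hφ : Real.sin φ ≠ 0)
    (v : PhaseSpace n) : (graphFst l₁ φ v : PhaseSpace n) + rot φ (graphSnd l₁ φ v) = v := by
  obtain ⟨a, b, rfl⟩ : ∃ a b : l₁, v = a + rot φ (b : PhaseSpace n) := by
    obtain ⟨c, hc, hJc⟩ : v - l₁.starProjection v ∈
        l₁.map (Jmap n : PhaseSpace n →ₗ[ℝ] PhaseSpace n) := by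
      rw [hl₁.map_Jmap]
      exact Submodule.sub_starProjection_mem_orthogonal v
    lift c to l₁ using hc
    refine ⟨l₁.orthogonalProjectionOnto v - (Real.cos φ / Real.sin φ) • c, (Real.sin φ)⁻¹ • c, ?_⟩
    have hv : v = l₁.orthogonalProjectionOnto v + Jmap n c := (eq_sub_iff_add_eq'.1 hJc).symm
    nth_rewrite 1 [hv]
    simp only [rot_apply, Submodule.coe_sub, Submodule.coe_smul, map_smul]
    match_scalars <;> field_simp
    ring
  rw [graphFst_apply hl₁ hφ, graphSnd_apply hl₁ hφ]

theorem omega_add_rot (hl₁ : IsLagrangian l₁) (a a' b b' : l₁) :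
    omega ((a : PhaseSpace n) + rot φ (a' : PhaseSpace n))
        ((b : PhaseSpace n) + rot φ (b' : PhaseSpace n)) =
      Real.sin φ * (inner ℝ a b' - inner ℝ a' b) := by
  have h0 (x y : l₁) : inner ℝ (Jmap n x) (y : PhaseSpace n) = 0 := hl₁.2 x x.2 y y.2
  rw [omega_eq_inner, map_add, inner_add_left, inner_add_right, inner_add_right, h0,
    ← rot_Jmap, inner_rot_rot, h0, rot_apply, rot_apply]
  simp only [inner_add_left, inner_add_right, inner_smul_left, inner_smul_right, h0, Jmap_Jmap,
    inner_Jmap_Jmap, inner_neg_left, conj_trivial, Submodule.coe_inner]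
  ring

theorem mem_rotate_iff_graphSnd_eq (hl₁ : IsLagrangian l₁) (hφ : Real.sin φ ≠ 0) {ψ : ℝ}
    (hψ : Real.sin (φ - ψ) ≠ 0) {v : PhaseSpace n} :
    v ∈ rotate ψ l₁ ↔
      graphSnd l₁ φ v = (Real.sin ψ / Real.sin (φ - ψ)) • graphFst l₁ φ v := by
  constructor
  · rintro ⟨g, hg, rfl⟩
    lift g to l₁ using hg
    have hsplit : rot ψ (g : PhaseSpace n) = ((Real.sin (φ - ψ) / Real.sin φ) • g : l₁) +
        rot φ (((Real.sin ψ / Real.sin φ) • g : l₁) : PhaseSpace n) := by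
      rw [← smul_right_inj hφ, sin_smul_rot]
      simp only [Submodule.coe_smul, map_smul]
      match_scalars <;> field_simp
    rw [ContinuousLinearMap.coe_coe, hsplit, graphSnd_apply hl₁ hφ, graphFst_apply hl₁ hφ]
    match_scalars
    field_simp
  · intro h
    refine ⟨(Real.sin φ / Real.sin (φ - ψ)) • graphFst l₁ φ v,
      l₁.smul_mem _ (Subtype.prop _), ?_⟩
    rw [ContinuousLinearMap.coe_coe, ← smul_right_inj hφ, sin_smul_rot]
    conv_rhs => rw [← graphFst_add_rot_graphSnd hl₁ hφ v, h]
    simp only [Submodule.coe_smul, map_smul]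
    match_scalars <;> field_simp

variable {E : Type*} [NormedAddCommGroup E] [NormedSpace ℝ E]

variable (l₁ φ) in
/-- For `F` with `graphFst l₁ φ ∘L F` invertible, the operator `N` for which the range of `F` is
`{a + rot φ (N a) | a ∈ l₁}`. -/
def graphOp (F : E →L[ℝ] PhaseSpace n) : l₁ →L[ℝ] l₁ :=
  graphSnd l₁ φ ∘L F ∘L (graphFst l₁ φ ∘L F).inverse

theorem isInvertible_graphFst_comp [FiniteDimensional ℝ E] (hE : Module.finrank ℝ E = n)
    (hl₁ : IsLagrangian l₁) (hφ : Real.sin φ ≠ 0) {F : E →L[ℝ] PhaseSpace n}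
    (hF : Function.Injective F)
    (h : Disjoint (LinearMap.range (F : E →ₗ[ℝ] PhaseSpace n)) (rotate φ l₁)) :
    (graphFst l₁ φ ∘L F).IsInvertible := by
  have hinj : Function.Injective (graphFst l₁ φ ∘L F) := by
    rw [injective_iff_map_eq_zero]
    intro a ha
    have hFa := graphFst_add_rot_graphSnd hl₁ hφ (F a)
    rw [show graphFst l₁ φ (F a) = 0 from ha, Submodule.coe_zero, zero_add] at hFa
    have h0 := Submodule.disjoint_def.1 h (F a) ⟨a, rfl⟩ ⟨_, Subtype.prop _, hFa⟩
    exact hF (h0.trans (map_zero F).symm)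
  exact ⟨(LinearEquiv.ofInjectiveOfFinrankEq (graphFst l₁ φ ∘L F : E →ₗ[ℝ] l₁) hinj
    (hE.trans hl₁.1.symm)).toContinuousLinearEquiv, rfl⟩

variable {F F' : E →L[ℝ] PhaseSpace n}

theorem apply_inverse_graphFst (hl₁ : IsLagrangian l₁) (hφ : Real.sin φ ≠ 0)
    (hF : (graphFst l₁ φ ∘L F).IsInvertible) (a : l₁) :
    F ((graphFst l₁ φ ∘L F).inverse a) =
      a + rot φ (graphOp l₁ φ F a : PhaseSpace n) := by
  conv_lhs => rw [← graphFst_add_rot_graphSnd hl₁ hφ (F _)]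
  congr 2
  exact hF.self_apply_inverse a

theorem omega_apply_inverse (hl₁ : IsLagrangian l₁) (hφ : Real.sin φ ≠ 0)
    (hF : (graphFst l₁ φ ∘L F).IsInvertible) (hF' : (graphFst l₁ φ ∘L F').IsInvertible)
    (a b : l₁) :
    omega (F ((graphFst l₁ φ ∘L F).inverse a)) (F' ((graphFst l₁ φ ∘L F').inverse b)) =
      Real.sin φ * (inner ℝ a (graphOp l₁ φ F' b) - inner ℝ (graphOp l₁ φ F a) b) := by
  rw [apply_inverse_graphFst hl₁ hφ hF, apply_inverse_graphFst hl₁ hφ hF', omega_add_rot hl₁]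

theorem graphOp_isSymmetric (hl₁ : IsLagrangian l₁) (hφ : Real.sin φ ≠ 0)
    (hF : (graphFst l₁ φ ∘L F).IsInvertible) (hω : ∀ x y, omega (F x) (F y) = 0) :
    (graphOp l₁ φ F : l₁ →ₗ[ℝ] l₁).IsSymmetric := by
  intro a b
  have h := omega_apply_inverse hl₁ hφ hF hF a b
  rw [hω, zero_eq_mul, or_iff_right hφ, sub_eq_zero] at h
  exact h.symm

theorem finrank_inf_rotate (hl₁ : IsLagrangian l₁) (hφ : Real.sin φ ≠ 0)
    (hF : (graphFst l₁ φ ∘L F).IsInvertible) {ψ : ℝ} (hψ : Real.sin (φ - ψ) ≠ 0) :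
    Module.finrank ℝ (LinearMap.range (F : E →ₗ[ℝ] PhaseSpace n) ⊓ rotate ψ l₁ :
      Submodule ℝ (PhaseSpace n)) =
    Module.finrank ℝ (Module.End.eigenspace (graphOp l₁ φ F : l₁ →ₗ[ℝ] l₁)
      (Real.sin ψ / Real.sin (φ - ψ))) := by
  set G : l₁ →ₗ[ℝ] PhaseSpace n :=
    ((F ∘L (graphFst l₁ φ ∘L F).inverse : l₁ →L[ℝ] PhaseSpace n) : l₁ →ₗ[ℝ] PhaseSpace n)
  have hfst (a : l₁) : graphFst l₁ φ (G a) = a := hF.self_apply_inverse a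
  have hrange : LinearMap.range (F : E →ₗ[ℝ] PhaseSpace n) = LinearMap.range G := by
    refine le_antisymm ?_ (LinearMap.range_comp_le_range _ _)
    rintro _ ⟨x, rfl⟩
    exact ⟨graphFst l₁ φ (F x), congrArg F (hF.inverse_apply_self x)⟩
  have hcomap : (rotate ψ l₁).comap G = Module.End.eigenspace (graphOp l₁ φ F : l₁ →ₗ[ℝ] l₁)
      (Real.sin ψ / Real.sin (φ - ψ)) := by
    ext a
    rw [Submodule.mem_comap, mem_rotate_iff_graphSnd_eq hl₁ hφ hψ, hfst,
      Module.End.mem_eigenspace_iff]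
    rfl
  rw [hrange, ← Submodule.map_comap_eq, hcomap]
  exact (Submodule.equivMapOfInjective G (Function.LeftInverse.injective hfst) _).finrank_eq.symm

theorem finrank_ker_graphOp (hl₁ : IsLagrangian l₁) (hφ : Real.sin φ ≠ 0)
    (hF : (graphFst l₁ φ ∘L F).IsInvertible) :
    Module.finrank ℝ (LinearMap.ker (graphOp l₁ φ F : l₁ →ₗ[ℝ] l₁)) =
      Module.finrank ℝ (LinearMap.range (F : E →ₗ[ℝ] PhaseSpace n) ⊓ l₁ :
        Submodule ℝ (PhaseSpace n)) := by
  have h := finrank_inf_rotate hl₁ hφ hF (ψ := 0) (by simpa using hφ)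
  rwa [rotate_zero, Real.sin_zero, zero_div, Module.End.eigenspace_zero, eq_comm] at h

theorem injOn_sin_div_sin {ε : ℝ} (hε : ε ∈ Set.Ioo 0 Real.pi) :
    Set.InjOn (fun θ => Real.sin (θ / 2) / Real.sin (ε / 2 - θ / 2)) (Set.Ico 0 ε) := by
  obtain ⟨h0, hpi⟩ := hε
  have hpos : ∀ θ ∈ Set.Ico 0 ε, 0 < Real.sin (ε / 2 - θ / 2) := fun θ hθ =>
    Real.sin_pos_of_pos_of_lt_pi (by linarith [hθ.2]) (by linarith [hθ.1])
  intro θ hθ η hη h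
  rw [div_eq_div_iff (hpos θ hθ).ne' (hpos η hη).ne', Real.sin_sub, Real.sin_sub] at h
  have hprod : Real.sin (ε / 2) * Real.sin (θ / 2 - η / 2) = 0 := by
    rw [Real.sin_sub]
    linear_combination h
  have hε2 : Real.sin (ε / 2) ≠ 0 :=
    (Real.sin_pos_of_pos_of_lt_pi (by linarith) (by linarith)).ne'
  have hsin := (mul_eq_zero.1 hprod).resolve_left hε2
  rw [Real.sin_eq_zero_iff_of_lt_of_lt (by linarith [hθ.1, hη.2]) (by linarith [hθ.2, hη.1])]
    at hsin
  linarith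

theorem surjOn_sin_div_sin {ε : ℝ} (hε : ε ∈ Set.Ioo 0 Real.pi) :
    Set.SurjOn (fun θ => Real.sin (θ / 2) / Real.sin (ε / 2 - θ / 2)) (Set.Ico 0 ε)
      (Set.Ici 0) := by
  obtain ⟨h0, hpi⟩ := hε
  intro κ hκ
  have hs : 0 < Real.sin (ε / 2) := Real.sin_pos_of_pos_of_lt_pi (by linarith) (by linarith)
  have hcont : ContinuousOn
      (fun θ => Real.sin (θ / 2) - κ * Real.sin (ε / 2 - θ / 2)) (Set.Icc 0 ε) := by fun_prop
  obtain ⟨θ, hθ, h⟩ := intermediate_value_Icc h0.le hcont (show (0 : ℝ) ∈ Set.Icc _ _ by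
    simp only [zero_div, Real.sin_zero, sub_zero, zero_sub, sub_self, mul_zero]
    exact ⟨neg_nonpos.2 (mul_nonneg hκ hs.le), hs.le⟩)
  have hne : θ ≠ ε := by
    rintro rfl
    simp only [sub_self, Real.sin_zero, mul_zero, sub_zero] at h
    exact hs.ne' h
  have hlt : θ < ε := lt_of_le_of_ne hθ.2 hne
  refine ⟨θ, ⟨hθ.1, hlt⟩, (div_eq_iff ?_).2 (sub_eq_zero.1 h)⟩
  exact (Real.sin_pos_of_pos_of_lt_pi (by linarith) (by linarith [hθ.1])).ne'

theorem arcCount_eq_nonnegCount {ε : ℝ} (hε : ε ∈ Set.Ioo 0 Real.pi) (hl₁ : IsLagrangian l₁)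
    (hl : IsLagrangian (LinearMap.range (F : E →ₗ[ℝ] PhaseSpace n)))
    (hF : (graphFst l₁ (ε / 2) ∘L F).IsInvertible) :
    arcCount (wTilde (LinearMap.range (F : E →ₗ[ℝ] PhaseSpace n)) l₁) ε =
      nonnegCount (graphOp l₁ (ε / 2) F) := by
  have hs {θ : ℝ} (hθ : θ ∈ Set.Ico 0 ε) : 0 < Real.sin (ε / 2 - θ / 2) :=
    Real.sin_pos_of_pos_of_lt_pi (by linarith [hθ.2]) (by linarith [hθ.1, hε.2, hε.1])
  have hs0 : Real.sin (ε / 2) ≠ 0 := by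
    simpa using (hs (θ := 0) ⟨le_rfl, hε.1⟩).ne'
  have hmaps : Set.MapsTo (fun θ => Real.sin (θ / 2) / Real.sin (ε / 2 - θ / 2)) (Set.Ico 0 ε)
      (Set.Ici 0) := fun θ hθ => div_nonneg (Real.sin_nonneg_of_nonneg_of_le_pi
    (by linarith [hθ.1]) (by linarith [hθ.2, hε.2, hθ.1])) (hs hθ).le
  refine finsum_mem_eq_of_bijOn _ ⟨hmaps, injOn_sin_div_sin hε, surjOn_sin_div_sin hε⟩
    fun θ hθ => ?_
  rw [finrank_circleEigenspace hl hl₁, finrank_inf_rotate hl₁ hs0 hF (hs hθ).ne']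

end Graph

/-! ### Spectral flow from left jumps -/

section LeftJumps

open Filter Topology

/-- The counting function `f` is constant immediately to the right of `t`, and increases by `d`
when `t` is reached from the left. -/
def HasLeftJump (f : ℝ → ℕ) (d : ℕ) (t : ℝ) : Prop :=
  (∀ᶠ s in 𝓝[>] t, f s = f t) ∧ ∀ᶠ s in 𝓝[<] t, f s + d = f t

theorem HasLeftJump.eq_zero {f : ℝ → ℕ} {d : ℕ} {t : ℝ} (h : HasLeftJump f d t)
    (hf : ∀ᶠ s in 𝓝 t, f s = f t) : d = 0 := by
  obtain ⟨s, hs, hs'⟩ := (h.2.and (hf.filter_mono nhdsWithin_le_nhds)).exists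
  omega

theorem eventually_eq_zero_of_hasLeftJump {f d : ℝ → ℕ} {t : ℝ}
    (h : ∀ᶠ s in 𝓝 t, HasLeftJump f (d s) s) : ∀ᶠ s in 𝓝[≠] t, d s = 0 := by
  have hopen {S : Set ℝ} (hS : IsOpen S) {p : ℝ → Prop} (hp : ∀ᶠ s in 𝓝[S] t, p s) :
      ∀ᶠ s in 𝓝[S] t, ∀ᶠ r in 𝓝 s, p r := by
    filter_upwards [eventually_eventually_nhdsWithin.2 hp, self_mem_nhdsWithin] with s hs hsS
    rwa [hS.nhdsWithin_eq hsS] at hs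
  have hright : ∀ᶠ s in 𝓝[>] t, ∀ᶠ r in 𝓝 s, f r = f t := hopen isOpen_Ioi h.self_of_nhds.1
  have hleft : ∀ᶠ s in 𝓝[<] t, ∀ᶠ r in 𝓝 s, f r + d t = f t := hopen isOpen_Iio h.self_of_nhds.2
  rw [← Set.Iio_union_Ioi, nhdsWithin_union, eventually_sup]
  constructor
  · filter_upwards [hleft, h.filter_mono nhdsWithin_le_nhds] with s hs hjump
    exact hjump.eq_zero (hs.mono fun r hr => by have := hs.self_of_nhds; omega)
  · filter_upwards [hright, h.filter_mono nhdsWithin_le_nhds] with s hs hjump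
    exact hjump.eq_zero (hs.mono fun r hr => hr.trans hs.self_of_nhds.symm)

theorem sub_eq_sub_of_hasLeftJump {f g d : ℝ → ℕ} {a b : ℝ} (hab : a ≤ b)
    (hf : ∀ t ∈ Set.Icc a b, HasLeftJump f (d t) t)
    (hg : ∀ t ∈ Set.Icc a b, HasLeftJump g (d t) t) :
    (f b : ℤ) - f a = g b - g a := by
  have hcont : ContinuousOn (fun t => (f t : ℤ) - g t) (Set.Icc a b) := by
    intro t ht
    refine ContinuousAt.continuousWithinAt (tendsto_nhds_of_eventually_eq ?_)
    rw [← nhdsLT_sup_nhdsGE, ← nhdsGT_sup_nhdsWithin_singleton]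
    simp only [nhdsWithin_singleton, eventually_sup, eventually_pure, and_true]
    constructor
    · filter_upwards [(hf t ht).2, (hg t ht).2] with s hfs hgs
      omega
    · filter_upwards [(hf t ht).1, (hg t ht).1] with s hfs hgs
      omega
  have := isPreconnected_Icc.constant hcont (Set.left_mem_Icc.2 hab) (Set.right_mem_Icc.2 hab)
  omega

section Support

variable {d : ℝ → ℕ} (hd : ∀ t, ∀ᶠ s in 𝓝[≠] t, d s = 0)

include hd

theorem finite_Icc_inter_support (a b : ℝ) : (Set.Icc a b ∩ Function.support d).Finite := by
  obtain ⟨T, -, hT⟩ := isCompact_Icc.elim_nhds_subcover (fun t => insert t {s | d s = 0})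
    fun t (_ : t ∈ Set.Icc a b) => insert_mem_nhds_iff.2 (hd t)
  refine T.finite_toSet.subset ?_
  rintro s ⟨hs, hs'⟩
  obtain ⟨t, ht, rfl | hst⟩ := Set.mem_iUnion₂.1 (hT hs)
  · exact ht
  · exact absurd hst hs'

theorem finsum_Ioc_add {a b c : ℝ} (hab : a ≤ b) (hbc : b ≤ c) :
    ∑ᶠ x ∈ Set.Ioc a c, d x = ∑ᶠ x ∈ Set.Ioc a b, d x + ∑ᶠ x ∈ Set.Ioc b c, d x := by
  have hfin (a b : ℝ) : (Set.Ioc a b ∩ Function.support d).Finite :=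
    (finite_Icc_inter_support hd a b).subset
      (Set.inter_subset_inter_left _ Set.Ioc_subset_Icc_self)
  rw [← Set.Ioc_union_Ioc_eq_Ioc hab hbc]
  exact finsum_mem_union' (Set.Ioc_disjoint_Ioc_of_le le_rfl) (hfin a b) (hfin b c)

theorem hasLeftJump_finsum_Ioc {a t : ℝ} (hat : a < t) :
    HasLeftJump (fun s => ∑ᶠ x ∈ Set.Ioc a s, d x) (d t) t := by
  obtain ⟨δ, hδ, hball⟩ := Metric.eventually_nhds_iff.1 (eventually_nhdsWithin_iff.1 (hd t))
  constructor
  · filter_upwards [Ioo_mem_nhdsGT (lt_add_of_pos_right t hδ)] with s hs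
    rw [finsum_Ioc_add hd hat.le hs.1.le, Nat.add_eq_left]
    refine finsum_mem_eq_zero_of_forall_eq_zero fun x hx => hball ?_ hx.1.ne'
    rw [Real.dist_eq, abs_lt]
    constructor <;> linarith [hs.2, hx.1, hx.2]
  · filter_upwards [Ioo_mem_nhdsLT (max_lt hat (sub_lt_self t hδ))] with s hs
    obtain ⟨has, hδs⟩ := max_lt_iff.1 hs.1
    rw [finsum_Ioc_add hd has.le hs.2.le, Nat.add_left_cancel_iff,
      ← finsum_mem_singleton (f := d) (a := t)]
    refine finsum_mem_inter_support_eq' _ _ _ fun x hx => ?_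
    rw [Set.mem_singleton_iff]
    constructor
    · rintro rfl
      exact ⟨hs.2, le_rfl⟩
    · intro hx'
      by_contra hne
      refine hx (hball ?_ hne)
      rw [Real.dist_eq, abs_lt]
      constructor <;> linarith [hx'.1, hx'.2]

theorem sub_eq_finsum_Ioc {f : ℝ → ℕ} {a b : ℝ} (hab : a ≤ b)
    (hf : ∀ t ∈ Set.Icc a b, HasLeftJump f (d t) t) :
    (f b : ℤ) - f a = ((∑ᶠ x ∈ Set.Ioc a b, d x : ℕ) : ℤ) := by
  have ha : a - 1 < a := sub_one_lt a
  rw [sub_eq_sub_of_hasLeftJump hab hf fun t ht => hasLeftJump_finsum_Ioc hd (ha.trans_le ht.1),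
    finsum_Ioc_add hd ha.le hab]
  push_cast
  ring

theorem FlowPartition.flow_eq_finsum_Ioc {A : ℝ → Matrix (Fin n) (Fin n) ℂ} {a b : ℝ}
    (P : FlowPartition A a b)
    (hjump : ∀ j, ∀ t ∈ Set.Icc (P.t j.castSucc) (P.t j.succ),
      HasLeftJump (fun s => arcCount (A s) (P.ε j)) (d t) t) :
    P.flow = ((∑ᶠ x ∈ Set.Ioc a b, d x : ℕ) : ℤ) := by
  set D : ℝ → ℤ := fun t => ((∑ᶠ x ∈ Set.Ioc a t, d x : ℕ) : ℤ) with hD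
  have hstep (j : Fin P.N) : (arcCount (A (P.t j.succ)) (P.ε j) : ℤ) -
      arcCount (A (P.t j.castSucc)) (P.ε j) = D (P.t j.succ) - D (P.t j.castSucc) := by
    have hlt : P.t j.castSucc < P.t j.succ := P.strictMono Fin.castSucc_lt_succ
    have ha : a ≤ P.t j.castSucc := P.t_zero.symm.le.trans (P.strictMono.monotone (Fin.zero_le _))
    have := finsum_Ioc_add hd ha hlt.le
    have := sub_eq_finsum_Ioc hd hlt.le (hjump j)
    simp only [hD]
    omega
  have htelescope : ∑ j : Fin P.N, (D (P.t j.succ) - D (P.t j.castSucc)) = D b - D a := by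
    have hsucc := Fin.sum_univ_succ fun i : Fin (P.N + 1) => D (P.t i)
    have hcastSucc := Fin.sum_univ_castSucc fun i : Fin (P.N + 1) => D (P.t i)
    rw [P.t_last] at hcastSucc
    rw [P.t_zero] at hsucc
    rw [Finset.sum_sub_distrib]
    linarith
  rw [FlowPartition.flow, Finset.sum_congr rfl fun j _ => hstep j, htelescope]
  simp only [hD, Set.Ioc_self, finsum_mem_empty, Nat.cast_zero, sub_zero]

end Support

theorem finite_circleEigenspace_ne_bot (A : Matrix (Fin n) (Fin n) ℂ) :
    (Set.Ioo (-Real.pi) Real.pi ∩ {θ | circleEigenspace A θ ≠ ⊥}).Finite := by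
  have hexp (θ : ℝ) : Complex.exp (Complex.I * ((Real.pi + θ : ℝ) : ℂ)) =
      Circle.exp (Real.pi + θ) := by rw [Circle.coe_exp, mul_comm]
  refine Set.Finite.of_finite_image (f := fun θ : ℝ => (Circle.exp (Real.pi + θ) : ℂ))
    ((Module.End.finite_hasEigenvalue (Matrix.toLin' A)).subset ?_) ?_
  · rintro _ ⟨θ, hθ, rfl⟩
    have heig : Module.End.eigenspace (Matrix.toLin' A) (Complex.exp _) ≠ ⊥ := hθ.2
    rwa [hexp] at heig
  · rintro θ ⟨hθ, -⟩ η ⟨hη, -⟩ h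
    refine add_left_cancel (Circle.exp_injOn_Ico (a := 0) (b := 2 * Real.pi) (by simp) ?_ ?_
      (Circle.coe_injective h))
    · constructor <;> linarith [hθ.1, hθ.2]
    · constructor <;> linarith [hη.1, hη.2]

theorem exists_circleEigenspace_eq_bot (A : Matrix (Fin n) (Fin n) ℂ) :
    ∃ ε ∈ Set.Ioo 0 Real.pi, circleEigenspace A ε = ⊥ ∧ circleEigenspace A (-ε) = ⊥ := by
  have hfin := finite_circleEigenspace_ne_bot A
  obtain ⟨ε, hε, hgap⟩ := (Set.Ioo_infinite Real.pi_pos).exists_notMem_finite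
    (hfin.union (hfin.preimage (f := Neg.neg) neg_injective.injOn))
  rw [Set.mem_union, not_or] at hgap
  refine ⟨ε, hε, ?_, ?_⟩
  · by_contra h
    exact hgap.1 ⟨⟨by linarith [hε.1, hε.2], hε.2⟩, h⟩
  · by_contra h
    exact hgap.2 ⟨⟨neg_lt_neg hε.2, by linarith [hε.1, hε.2]⟩, h⟩

theorem exists_equidistant_subdivision {a b : ℝ} (hab : a < b) {q : Set ℝ → Prop}
    (hmono : ∀ ⦃U W⦄, U ⊆ W → q W → q U) (hq : ∀ t ∈ Set.Icc a b, ∃ U ∈ 𝓝 t, q U) :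
    ∃ (N : ℕ) (h : ℝ), 0 < h ∧ a + N * h = b ∧
      ∀ j < N, q (Set.Icc (a + j * h) (a + (j + 1 : ℕ) * h)) := by
  choose U hU hqU using hq
  obtain ⟨V, hV, hVU⟩ := lebesgue_number_lemma_nhds' isCompact_Icc hU
  obtain ⟨δ, hδ, hδV⟩ := Metric.mem_uniformity_dist.1 hV
  obtain ⟨N, hN⟩ := exists_nat_gt ((b - a) / δ)
  have hN0 : (0 : ℝ) < N := (div_pos (sub_pos.2 hab) hδ).trans hN
  set h := (b - a) / N
  have hpos : 0 < h := div_pos (sub_pos.2 hab) hN0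
  have hlt : h < δ := (div_lt_comm₀ hδ hN0).1 hN
  have hNh : N * h = b - a := mul_div_cancel₀ _ hN0.ne'
  refine ⟨N, h, hpos, by linarith, fun j hj => ?_⟩
  have hjN : (j : ℝ) * h ≤ N * h := by gcongr
  obtain ⟨c, hc⟩ := hVU (a + j * h) ⟨le_add_of_nonneg_right (by positivity), by linarith⟩
  refine hmono (fun τ hτ => hc (hδV ?_)) (hqU c c.2)
  push_cast at hτ
  rw [Real.dist_eq, abs_lt]
  constructor <;> linarith [hτ.1, hτ.2]

theorem nonempty_flowPartition {A : ℝ → Matrix (Fin n) (Fin n) ℂ} {a b : ℝ} (hab : a < b)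
    (hA : ∀ t ∈ Set.Icc a b, ∃ ε ∈ Set.Ioo 0 Real.pi, ∀ᶠ s in 𝓝 t,
      circleEigenspace (A s) ε = ⊥ ∧ circleEigenspace (A s) (-ε) = ⊥) :
    Nonempty (FlowPartition A a b) := by
  obtain ⟨N, h, hpos, hNh, hgap⟩ := exists_equidistant_subdivision hab
    (q := fun U => ∃ ε ∈ Set.Ioo 0 Real.pi, ∀ s ∈ U,
      circleEigenspace (A s) ε = ⊥ ∧ circleEigenspace (A s) (-ε) = ⊥)
    (fun U W hUW ⟨ε, hε, hW⟩ => ⟨ε, hε, fun s hs => hW s (hUW hs)⟩)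
    (fun t ht => let ⟨ε, hε, hs⟩ := hA t ht; ⟨_, hs, ε, hε, fun _ => id⟩)
  choose ε hε hgap using fun j : Fin N => hgap j j.2
  refine ⟨⟨N, fun i => a + i * h, ε, fun i j hij => ?_, by simp, hNh, hε, hgap⟩⟩
  have : (i : ℝ) < j := by exact_mod_cast hij
  dsimp only
  gcongr

end LeftJumps

/-! ### Monotone paths of Lagrangian subspaces -/

section Frames

open Filter Topology

theorem sin_half_pos {ε : ℝ} (hε : ε ∈ Set.Ioo 0 Real.pi) : 0 < Real.sin (ε / 2) :=
  Real.sin_pos_of_pos_of_lt_pi (by linarith [hε.1]) (by linarith [hε.1, hε.2])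

theorem continuous_starProjection_range {X E E' : Type*} [TopologicalSpace X]
    [NormedAddCommGroup E] [InnerProductSpace ℝ E] [FiniteDimensional ℝ E]
    [NormedAddCommGroup E'] [InnerProductSpace ℝ E'] [CompleteSpace E'] {F : X → E →L[ℝ] E'}
    (hF : Continuous F) (hinj : ∀ x, Function.Injective (F x)) :
    Continuous fun x => (LinearMap.range (F x : E →ₗ[ℝ] E')).starProjection := by
  have := FiniteDimensional.complete ℝ E
  set R : X → E →L[ℝ] E := fun x => (F x).adjoint ∘L F x
  have hadj : Continuous fun x => (F x).adjoint := ContinuousLinearMap.adjoint.continuous.comp hF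
  have hR (x : X) : (R x).IsInvertible := by
    have hker : Function.Injective (R x : E →ₗ[ℝ] E) :=
      (injective_iff_map_eq_zero (R x)).2 fun a ha => hinj x <| by
        rw [map_zero, ← inner_self_eq_zero (𝕜 := ℝ), ← ContinuousLinearMap.adjoint_inner_right]
        exact (congrArg (inner ℝ a) ha).trans (inner_zero_right a)
    exact ⟨(LinearEquiv.ofInjectiveEndo _ hker).toContinuousLinearEquiv, rfl⟩
  have hinv : Continuous fun x => (R x).inverse := continuous_iff_continuousAt.2 fun x =>
    ContinuousAt.comp (f := R) ((hR x).contDiffAt_map_inverse (n := 0)).continuousAt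
      (hadj.clm_comp hF).continuousAt
  have hproj (x : X) : (LinearMap.range (F x : E →ₗ[ℝ] E')).starProjection =
      F x ∘L (R x).inverse ∘L (F x).adjoint := by
    ext1 v
    refine Submodule.eq_starProjection_of_mem_orthogonal ⟨_, rfl⟩ ?_
    rw [Submodule.mem_orthogonal]
    rintro _ ⟨a, rfl⟩
    have hRv : (F x).adjoint (F x ((R x).inverse ((F x).adjoint v))) = (F x).adjoint v :=
      (hR x).self_apply_inverse _
    change inner ℝ (F x a) (v - F x ((R x).inverse ((F x).adjoint v))) = 0
    rw [← ContinuousLinearMap.adjoint_inner_right, map_sub, hRv, sub_self, inner_zero_right]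
  simp only [hproj]
  exact hF.clm_comp (hinv.clm_comp hadj)

theorem continuous_projMatrix_range {X E : Type*} [TopologicalSpace X] [NormedAddCommGroup E]
    [InnerProductSpace ℝ E] [FiniteDimensional ℝ E] {F : X → E →L[ℝ] PhaseSpace n}
    (hF : Continuous F) (hinj : ∀ x, Function.Injective (F x)) :
    Continuous fun x => projMatrix (LinearMap.range (F x : E →ₗ[ℝ] PhaseSpace n)) :=
  (LinearMap.continuous_of_finiteDimensional (Matrix.toEuclideanCLM (𝕜 := ℝ)
    (n := Fin n ⊕ Fin n)).symm.toAlgEquiv.toLinearMap).comp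
      (continuous_starProjection_range hF hinj)

/-- A continuous path of Lagrangian subspaces of `ℝ²ⁿ`, given as the ranges of injective operators
`F t`. It turns in the positive direction: by `omega_eq`, the derivative at `s = t` of
`ω (F t z) (F s z)` is the square of the norm of `y t z`, where the operator `y t` is injective. -/
structure MonotoneFrame (n : ℕ) (E G : Type*) [NormedAddCommGroup E] [InnerProductSpace ℝ E]
    [FiniteDimensional ℝ E] [NormedAddCommGroup G] [InnerProductSpace ℝ G] where
  F : ℝ → E →L[ℝ] PhaseSpace n
  y : ℝ → E →L[ℝ] G
  continuous_F : Continuous F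
  continuous_y : Continuous y
  finrank_eq : Module.finrank ℝ E = n
  injective_F : ∀ t, Function.Injective (F t)
  injective_y : ∀ t, Function.Injective (y t)
  omega_eq : ∀ t s z w, omega (F t z) (F s w) = (s - t) * inner ℝ (y t z) (y s w)

namespace MonotoneFrame

variable {E G : Type*} [NormedAddCommGroup E] [InnerProductSpace ℝ E] [FiniteDimensional ℝ E]
  [NormedAddCommGroup G] [InnerProductSpace ℝ G] (Y : MonotoneFrame n E G)
  {l₁ : Submodule ℝ (PhaseSpace n)}

/-- The Lagrangian subspace at the parameter `t`. -/
def space (t : ℝ) : Submodule ℝ (PhaseSpace n) :=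
  LinearMap.range (Y.F t : E →ₗ[ℝ] PhaseSpace n)

theorem omega_self (t : ℝ) (z w : E) : omega (Y.F t z) (Y.F t w) = 0 := by
  rw [Y.omega_eq, sub_self, zero_mul]

theorem isLagrangian_space (t : ℝ) : IsLagrangian (Y.space t) := by
  refine ⟨?_, ?_⟩
  · rw [space, LinearMap.finrank_range_of_inj (Y.injective_F t), Y.finrank_eq]
  · rintro _ ⟨z, rfl⟩ _ ⟨w, rfl⟩
    exact Y.omega_self t z w

/-- The dimension of the intersection with the target `l₁`. -/
def crossing (l₁ : Submodule ℝ (PhaseSpace n)) (t : ℝ) : ℕ :=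
  Module.finrank ℝ (Y.space t ⊓ l₁ : Submodule ℝ (PhaseSpace n))

theorem circleEigenspace_eq_bot_iff (hl₁ : IsLagrangian l₁) {θ : ℝ} (hθ : Real.sin (θ / 2) ≠ 0)
    (t : ℝ) : circleEigenspace (wTilde (Y.space t) l₁) θ = ⊥ ↔
      (graphFst l₁ (θ / 2) ∘L Y.F t).IsInvertible := by
  rw [circleEigenspace_wTilde_eq_bot_iff (Y.isLagrangian_space t) hl₁]
  refine ⟨isInvertible_graphFst_comp Y.finrank_eq hl₁ hθ (Y.injective_F t), fun h => ?_⟩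
  rw [Submodule.disjoint_def]
  rintro _ ⟨z, rfl⟩ ⟨b, hb, hbz⟩
  have hz : graphFst l₁ (θ / 2) (Y.F t z) = 0 := by
    have := graphFst_apply hl₁ hθ 0 ⟨b, hb⟩
    rw [ZeroMemClass.coe_zero, zero_add] at this
    exact (congrArg (graphFst l₁ (θ / 2)) hbz).symm.trans this
  obtain rfl : z = 0 := h.injective (hz.trans (map_zero (graphFst l₁ (θ / 2) ∘L Y.F t)).symm)
  exact map_zero _

theorem eventually_isInvertible {φ t : ℝ} (h : (graphFst l₁ φ ∘L Y.F t).IsInvertible) :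
    ∀ᶠ s in 𝓝 t, (graphFst l₁ φ ∘L Y.F s).IsInvertible := by
  have := FiniteDimensional.complete ℝ E
  obtain ⟨e, he⟩ := h
  have hcont : ContinuousAt (fun s => graphFst l₁ φ ∘L Y.F s) t :=
    (continuous_const.clm_comp Y.continuous_F).continuousAt
  exact hcont (he ▸ e.nhds)

theorem continuousAt_inverse {φ t : ℝ} (h : (graphFst l₁ φ ∘L Y.F t).IsInvertible) :
    ContinuousAt (fun s => (graphFst l₁ φ ∘L Y.F s).inverse) t :=
  have := FiniteDimensional.complete ℝ E
  ContinuousAt.comp (f := fun s => graphFst l₁ φ ∘L Y.F s)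
    (h.contDiffAt_map_inverse (n := 0)).continuousAt
    (continuous_const.clm_comp Y.continuous_F).continuousAt

theorem eventually_circleEigenspace_eq_bot (hl₁ : IsLagrangian l₁) {θ t : ℝ}
    (hθ : Real.sin (θ / 2) ≠ 0) (h : circleEigenspace (wTilde (Y.space t) l₁) θ = ⊥) :
    ∀ᶠ s in 𝓝 t, circleEigenspace (wTilde (Y.space s) l₁) θ = ⊥ :=
  (Y.eventually_isInvertible ((Y.circleEigenspace_eq_bot_iff hl₁ hθ t).1 h)).mono fun s hs =>
    (Y.circleEigenspace_eq_bot_iff hl₁ hθ s).2 hs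

theorem eventually_inner_pos {φ t : ℝ} (h : (graphFst l₁ φ ∘L Y.F t).IsInvertible) :
    ∀ᶠ s in 𝓝 t, ∀ a, a ≠ 0 → 0 < inner ℝ (Y.y t ((graphFst l₁ φ ∘L Y.F t).inverse a))
      (Y.y s ((graphFst l₁ φ ∘L Y.F s).inverse a)) := by
  set T : ℝ → l₁ →L[ℝ] G := fun s => Y.y s ∘L (graphFst l₁ φ ∘L Y.F s).inverse
  have hT : ContinuousAt T t := Y.continuous_y.continuousAt.clm_comp (Y.continuousAt_inverse h)
  have hpos : ∀ a ∈ (⊤ : Submodule ℝ l₁), a ≠ 0 → 0 < inner ℝ (T t a) (T t a) := by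
    refine fun a _ ha => real_inner_self_pos.2 fun h0 => ha ?_
    have hinj : Function.Injective (T t) := (Y.injective_y t).comp h.inverse.injective
    exact hinj (h0.trans (map_zero (T t)).symm)
  refine (eventually_forall_mem_pos (q := fun s a => inner ℝ (T t a) (T s a)) (fun a => ?_)
    (fun s c a => ?_) hpos).mono fun s hs a ha => hs a trivial ha
  · have hfst : ContinuousAt (fun z : ℝ × l₁ => T z.1) (t, a) :=
      ContinuousAt.comp (g := T) (f := Prod.fst) hT continuousAt_fst
    have happly : ContinuousAt (fun z : ℝ × l₁ => (T z.1) z.2) (t, a) :=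
      ContinuousAt.clm_apply (f := fun z : ℝ × l₁ => T z.1) hfst continuousAt_snd
    exact ((T t).continuous.comp continuous_snd).continuousAt.inner happly
  · rw [map_smul, map_smul, real_inner_smul_left, real_inner_smul_right]
    ring

theorem sin_mul_inner_graphOp_sub (hl₁ : IsLagrangian l₁) {φ t s : ℝ} (hφ : Real.sin φ ≠ 0)
    (ht : (graphFst l₁ φ ∘L Y.F t).IsInvertible) (hs : (graphFst l₁ φ ∘L Y.F s).IsInvertible)
    (a : l₁) :
    Real.sin φ * (inner ℝ (graphOp l₁ φ (Y.F s) a) a - inner ℝ (graphOp l₁ φ (Y.F t) a) a) =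
      (s - t) * inner ℝ (Y.y t ((graphFst l₁ φ ∘L Y.F t).inverse a))
        (Y.y s ((graphFst l₁ φ ∘L Y.F s).inverse a)) := by
  rw [← Y.omega_eq, omega_apply_inverse hl₁ hφ ht hs, real_inner_comm a]

theorem hasLeftJump_arcCount (hl₁ : IsLagrangian l₁) {ε t : ℝ} (hε : ε ∈ Set.Ioo 0 Real.pi)
    (hgap : circleEigenspace (wTilde (Y.space t) l₁) ε = ⊥) :
    HasLeftJump (fun s => arcCount (wTilde (Y.space s) l₁) ε) (Y.crossing l₁ t) t := by
  have hsin := sin_half_pos hε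
  have ht := (Y.circleEigenspace_eq_bot_iff hl₁ hsin.ne' t).1 hgap
  set N : ℝ → l₁ →L[ℝ] l₁ := fun s => graphOp l₁ (ε / 2) (Y.F s)
  have hsymm (s : ℝ) (hs : (graphFst l₁ (ε / 2) ∘L Y.F s).IsInvertible) :
      (N s : l₁ →ₗ[ℝ] l₁).IsSymmetric :=
    graphOp_isSymmetric hl₁ hsin.ne' hs (Y.omega_self s)
  have hcont : ContinuousAt N t :=
    continuousAt_const.clm_comp
      (Y.continuous_F.continuousAt.clm_comp (Y.continuousAt_inverse ht))
  have hcount (s : ℝ) (hs : (graphFst l₁ (ε / 2) ∘L Y.F s).IsInvertible) :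
      arcCount (wTilde (Y.space s) l₁) ε = nonnegCount (N s) :=
    arcCount_eq_nonnegCount hε hl₁ (Y.isLagrangian_space s) hs
  have hker : Module.finrank ℝ (LinearMap.ker (N t : l₁ →ₗ[ℝ] l₁)) = Y.crossing l₁ t :=
    finrank_ker_graphOp hl₁ hsin.ne' ht
  have hmono (s : ℝ) (hs : (graphFst l₁ (ε / 2) ∘L Y.F s).IsInvertible) (a : l₁) :=
    Y.sin_mul_inner_graphOp_sub hl₁ hsin.ne' ht hs a
  constructor
  · filter_upwards [nhdsWithin_le_nhds (Y.eventually_isInvertible ht),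
      nhdsWithin_le_nhds (Y.eventually_inner_pos ht), self_mem_nhdsWithin,
      nhdsWithin_le_nhds (hcont (eventually_nonnegCount_eq_of_lt (hsymm t ht)))]
      with s hs hpos hts hN
    rw [hcount s hs, hcount t ht]
    refine hN (hsymm s hs) fun a ha => sub_pos.1 ((mul_pos_iff_of_pos_left hsin).1 ?_)
    exact (hmono s hs a).symm ▸ mul_pos (sub_pos.2 hts) (hpos a ha)
  · filter_upwards [nhdsWithin_le_nhds (Y.eventually_isInvertible ht),
      nhdsWithin_le_nhds (Y.eventually_inner_pos ht), self_mem_nhdsWithin,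
      nhdsWithin_le_nhds (hcont (eventually_nonnegCount_add_finrank_ker_of_lt (hsymm t ht)))]
      with s hs hpos hst hN
    rw [hcount s hs, hcount t ht, ← hker]
    refine hN (hsymm s hs) fun a ha => sub_neg.1 (neg_of_mul_neg_right ?_ hsin.le)
    exact (hmono s hs a).symm ▸ mul_neg_of_neg_of_pos (sub_neg.2 hst) (hpos a ha)

theorem eventually_crossing_eq_zero (hl₁ : IsLagrangian l₁) (t : ℝ) :
    ∀ᶠ s in 𝓝[≠] t, Y.crossing l₁ s = 0 :=
  let ⟨_, hε, hgap, _⟩ := exists_circleEigenspace_eq_bot (wTilde (Y.space t) l₁)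
  eventually_eq_zero_of_hasLeftJump
    ((Y.eventually_circleEigenspace_eq_bot hl₁ (sin_half_pos hε).ne' hgap).mono fun _ =>
      Y.hasLeftJump_arcCount hl₁ hε)

theorem hasMaslovIndex (hl₁ : IsLagrangian l₁) {a b : ℝ} (hab : a < b) :
    HasMaslovIndex Y.space l₁ a b ((∑ᶠ t ∈ Set.Ioc a b, Y.crossing l₁ t : ℕ) : ℤ) where
  target := hl₁
  lagrangian t _ := Y.isLagrangian_space t
  continuous := (continuous_projMatrix_range Y.continuous_F Y.injective_F).continuousOn
  exists_partition := nonempty_flowPartition hab fun t _ => by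
    obtain ⟨ε, hε, hpos, hneg⟩ := exists_circleEigenspace_eq_bot (wTilde (Y.space t) l₁)
    have hsin := (sin_half_pos hε).ne'
    have hsin' : Real.sin (-ε / 2) ≠ 0 := by rwa [neg_div, Real.sin_neg, neg_ne_zero]
    exact ⟨ε, hε, (Y.eventually_circleEigenspace_eq_bot hl₁ hsin hpos).and
      (Y.eventually_circleEigenspace_eq_bot hl₁ hsin' hneg)⟩
  flow_eq P := P.flow_eq_finsum_Ioc (Y.eventually_crossing_eq_zero hl₁) fun j t ht =>
    Y.hasLeftJump_arcCount hl₁ (P.ε_mem j) (P.gap j t ht).1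

end MonotoneFrame

end Frames

/-! ### Linear differential equations on the unit interval -/

section Volterra

variable {E : Type*} [NormedAddCommGroup E]

/-- The extension of a function on `[0, 1]` to `ℝ` which is constant on both sides. -/
def extendUnit (f : C(Set.Icc (0 : ℝ) 1, E)) : ℝ → E := Set.IccExtend zero_le_one f

theorem continuous_extendUnit (f : C(Set.Icc (0 : ℝ) 1, E)) : Continuous (extendUnit f) :=
  f.continuous.Icc_extend'

theorem extendUnit_of_mem (f : C(Set.Icc (0 : ℝ) 1, E)) {x : ℝ} (hx : x ∈ Set.Icc (0 : ℝ) 1) :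
    extendUnit f x = f ⟨x, hx⟩ := Set.IccExtend_of_mem _ _ hx

variable [NormedSpace ℝ E]

theorem continuous_volterraIntegrand (A : C(ℝ, E →L[ℝ] E)) (f : C(Set.Icc (0 : ℝ) 1, E)) :
    Continuous fun t => A t (extendUnit f t) :=
  A.continuous.clm_apply (continuous_extendUnit f)

/-- The function `x ↦ ∫₀ˣ A(t) f(t) dt` on `[0, 1]`. -/
def volterraFun (A : C(ℝ, E →L[ℝ] E)) (f : C(Set.Icc (0 : ℝ) 1, E)) : C(Set.Icc (0 : ℝ) 1, E) where
  toFun x := ∫ t in (0 : ℝ)..x, A t (extendUnit f t)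
  continuous_toFun := (intervalIntegral.continuous_primitive
    (fun _ _ => (continuous_volterraIntegrand A f).intervalIntegrable _ _) 0).comp
      continuous_subtype_val

theorem volterraFun_apply (A : C(ℝ, E →L[ℝ] E)) (f : C(Set.Icc (0 : ℝ) 1, E))
    (x : Set.Icc (0 : ℝ) 1) : volterraFun A f x = ∫ t in (0 : ℝ)..x, A t (extendUnit f t) := rfl

theorem norm_volterraFun_apply_le {A : C(ℝ, E →L[ℝ] E)} {M : ℝ}
    (hM : ∀ t ∈ Set.Icc (0 : ℝ) 1, ‖A t‖ ≤ M) {C : ℝ} {k : ℕ} {f : C(Set.Icc (0 : ℝ) 1, E)}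
    (hf : ∀ x : Set.Icc (0 : ℝ) 1, ‖f x‖ ≤ (M * x) ^ k / k.factorial * C)
    (x : Set.Icc (0 : ℝ) 1) :
    ‖volterraFun A f x‖ ≤ (M * x) ^ (k + 1) / (k + 1).factorial * C := by
  have hbound (t : ℝ) (ht : t ∈ Set.Ioc (0 : ℝ) x) :
      ‖A t (extendUnit f t)‖ ≤ (M ^ (k + 1) / k.factorial * C) * t ^ k := by
    have ht' : t ∈ Set.Icc (0 : ℝ) 1 := ⟨ht.1.le, ht.2.trans x.2.2⟩
    calc ‖A t (extendUnit f t)‖ ≤ M * ‖extendUnit f t‖ := (A t).le_of_opNorm_le (hM t ht') _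
      _ ≤ M * ((M * t) ^ k / k.factorial * C) := by
        rw [extendUnit_of_mem f ht']
        exact mul_le_mul_of_nonneg_left (hf ⟨t, ht'⟩) ((norm_nonneg _).trans (hM t ht'))
      _ = (M ^ (k + 1) / k.factorial * C) * t ^ k := by ring
  calc ‖volterraFun A f x‖ ≤ ∫ t in (0 : ℝ)..x, (M ^ (k + 1) / k.factorial * C) * t ^ k :=
        intervalIntegral.norm_integral_le_of_norm_le x.2.1 (Filter.Eventually.of_forall hbound)
          (Continuous.intervalIntegrable (by fun_prop) _ _)
    _ = (M * x) ^ (k + 1) / (k + 1).factorial * C := by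
      rw [intervalIntegral.integral_const_mul, integral_pow, zero_pow k.succ_ne_zero,
        Nat.factorial_succ]
      push_cast
      field_simp
      ring

/-- The operator `f ↦ ∫₀ˣ A(t) f(t) dt` on the continuous functions on `[0, 1]`. -/
def volterra (A : C(ℝ, E →L[ℝ] E)) : C(Set.Icc (0 : ℝ) 1, E) →L[ℝ] C(Set.Icc (0 : ℝ) 1, E) :=
  LinearMap.mkContinuousOfExistsBound
    { toFun := volterraFun A
      map_add' := fun f g => by
        ext x
        rw [ContinuousMap.add_apply, volterraFun_apply, volterraFun_apply, volterraFun_apply,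
          ← intervalIntegral.integral_add
            ((continuous_volterraIntegrand A f).intervalIntegrable _ _)
            ((continuous_volterraIntegrand A g).intervalIntegrable _ _)]
        refine intervalIntegral.integral_congr fun t _ => ?_
        exact map_add (A t) _ _
      map_smul' := fun c f => by
        ext x
        rw [ContinuousMap.smul_apply, volterraFun_apply, volterraFun_apply, RingHom.id_apply,
          ← intervalIntegral.integral_smul]
        refine intervalIntegral.integral_congr fun t _ => ?_
        exact map_smul (A t) _ _ }
    (by
      obtain ⟨M, hM⟩ := (isCompact_Icc (a := (0 : ℝ)) (b := 1)).exists_bound_of_continuousOn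
        A.continuous.continuousOn
      have hM0 : 0 ≤ M := (norm_nonneg _).trans (hM 0 (by simp))
      refine ⟨M, fun f => (ContinuousMap.norm_le _ (by positivity)).2 fun x => ?_⟩
      calc ‖volterraFun A f x‖ ≤ M * x * ‖f‖ := by
            simpa using norm_volterraFun_apply_le (k := 0) hM (C := ‖f‖)
              (fun x => by simpa using f.norm_coe_le_norm x) x
        _ ≤ M * ‖f‖ := mul_le_mul_of_nonneg_right (mul_le_of_le_one_right hM0 x.2.2)
          (norm_nonneg _))

theorem volterra_apply (A : C(ℝ, E →L[ℝ] E)) (f : C(Set.Icc (0 : ℝ) 1, E))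
    (x : Set.Icc (0 : ℝ) 1) : volterra A f x = ∫ t in (0 : ℝ)..x, A t (extendUnit f t) := rfl

theorem volterra_add_smul (A B : C(ℝ, E →L[ℝ] E)) (c : ℝ) :
    volterra (A + c • B) = volterra A + c • volterra B := by
  ext f x
  rw [add_apply, smul_apply, ContinuousMap.add_apply, ContinuousMap.smul_apply, volterra_apply,
    volterra_apply, volterra_apply, ← intervalIntegral.integral_smul,
    ← intervalIntegral.integral_add (g := fun t => c • B t (extendUnit f t))
      ((continuous_volterraIntegrand A f).intervalIntegrable _ _)
      (((continuous_volterraIntegrand B f).const_smul c).intervalIntegrable _ _)]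
  rfl

theorem norm_volterra_pow_le {A : C(ℝ, E →L[ℝ] E)} {M : ℝ}
    (hM : ∀ t ∈ Set.Icc (0 : ℝ) 1, ‖A t‖ ≤ M) (k : ℕ) :
    ‖volterra A ^ k‖ ≤ M ^ k / k.factorial := by
  have hM0 : 0 ≤ M := (norm_nonneg _).trans (hM 0 (by simp))
  have hpow (f : C(Set.Icc (0 : ℝ) 1, E)) (x : Set.Icc (0 : ℝ) 1) :
      ‖(volterra A ^ k) f x‖ ≤ (M * x) ^ k / k.factorial * ‖f‖ := by
    induction k generalizing x with
    | zero => simpa using f.norm_coe_le_norm x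
    | succ k ih =>
      rw [pow_succ', mul_apply_eq_comp]
      exact norm_volterraFun_apply_le hM ih x
  refine ContinuousLinearMap.opNorm_le_bound _ (by positivity) fun f =>
    (ContinuousMap.norm_le _ (by positivity)).2 fun x => (hpow f x).trans ?_
  have hx : 0 ≤ M * x := mul_nonneg hM0 x.2.1
  gcongr
  exact mul_le_of_le_one_right hM0 x.2.2

/-- The constant functions on `[0, 1]`. -/
def constUnit (E : Type*) [NormedAddCommGroup E] [NormedSpace ℝ E] :
    E →L[ℝ] C(Set.Icc (0 : ℝ) 1, E) :=
  LinearMap.mkContinuous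
    { toFun := ContinuousMap.const _
      map_add' := fun _ _ => rfl
      map_smul' := fun _ _ => rfl } 1
    (fun v => (ContinuousMap.norm_le _ (by positivity)).2 fun _ => (one_mul ‖v‖).ge)

theorem constUnit_apply (v : E) (x : Set.Icc (0 : ℝ) 1) : constUnit E v x = v := rfl

/-- The solution on `[0, 1]` of `y' = A y` as a function of its initial value `y(0)`. -/
def solOp (A : C(ℝ, E →L[ℝ] E)) : E →L[ℝ] C(Set.Icc (0 : ℝ) 1, E) :=
  Ring.inverse (1 - volterra A) ∘L constUnit E

/-- The solution of `y' = A y` with initial value `v`, extended to `ℝ` as a differentiable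
function. -/
def solFun (A : C(ℝ, E →L[ℝ] E)) (v : E) (x : ℝ) : E :=
  v + ∫ t in (0 : ℝ)..x, A t (extendUnit (solOp A v) t)

theorem solFun_zero (A : C(ℝ, E →L[ℝ] E)) (v : E) : solFun A v 0 = v := by simp [solFun]

theorem continuous_solFun (A : C(ℝ, E →L[ℝ] E)) (v : E) : Continuous (solFun A v) :=
  continuous_const.add (intervalIntegral.continuous_primitive
    (fun _ _ => (continuous_volterraIntegrand A _).intervalIntegrable _ _) 0)

theorem HasWeakDeriv.continuousOn {u g : ℝ → E} (h : HasWeakDeriv 1 u g) :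
    ContinuousOn u (Set.Icc 0 1) := by
  have hint : IntegrableOn g (Set.Icc 0 1) := h.1.integrable one_le_two
  rw [← Set.uIcc_of_le zero_le_one] at hint
  have hcont := intervalIntegral.continuousOn_primitive_interval hint
  rw [Set.uIcc_of_le zero_le_one] at hcont
  exact (continuousOn_const.add hcont).congr h.2

variable [CompleteSpace E]

theorem isUnit_one_sub_volterra (A : C(ℝ, E →L[ℝ] E)) : IsUnit (1 - volterra A) := by
  obtain ⟨M, hM⟩ := isCompact_Icc.exists_bound_of_continuousOn A.continuous.continuousOn
  obtain ⟨k, hk⟩ := ((FloorSemiring.tendsto_pow_div_factorial_atTop M).eventually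
    (gt_mem_nhds one_pos)).exists
  have hunit : IsUnit (1 - volterra A ^ k) :=
    isUnit_one_sub_of_norm_lt_one (R := C(Set.Icc (0 : ℝ) 1, E) →L[ℝ] C(Set.Icc (0 : ℝ) 1, E))
      ((norm_volterra_pow_le hM k).trans_lt hk)
  rw [← mul_neg_geom_sum] at hunit
  refine ((Commute.isUnit_mul_iff ?_).1 hunit).1
  refine Commute.sub_left (Commute.one_left _) ?_
  exact Commute.sum_right _ _ _ fun i _ => (Commute.refl _).pow_right i

theorem solOp_eq_iff {A : C(ℝ, E →L[ℝ] E)} {v : E} {f : C(Set.Icc (0 : ℝ) 1, E)} :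
    solOp A v = f ↔ ∀ x : Set.Icc (0 : ℝ) 1, f x = v + ∫ t in (0 : ℝ)..x, A t (extendUnit f t) := by
  have hunit := isUnit_one_sub_volterra A
  have hfix : solOp A v = f ↔ constUnit E v = (1 - volterra A) f := by
    constructor
    · rintro rfl
      exact (DFunLike.congr_fun (Ring.mul_inverse_cancel _ hunit) (constUnit E v)).symm
    · intro h
      rw [solOp, ContinuousLinearMap.comp_apply, h]
      exact DFunLike.congr_fun (Ring.inverse_mul_cancel _ hunit) f
  rw [hfix, eq_comm, ContinuousMap.ext_iff]
  refine forall_congr' fun x => ?_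
  rw [sub_apply, one_apply_eq_self, ContinuousMap.sub_apply, constUnit_apply, volterra_apply,
    sub_eq_iff_eq_add]

theorem continuous_solOp (A B : C(ℝ, E →L[ℝ] E)) :
    Continuous fun c : ℝ => solOp (A + c • B) := by
  unfold solOp
  simp only [volterra_add_smul]
  refine Continuous.clm_comp (continuous_iff_continuousAt.2 fun c => ?_) continuous_const
  obtain ⟨U, hU⟩ := isUnit_one_sub_volterra (A + c • B)
  rw [volterra_add_smul] at hU
  refine ContinuousAt.comp (g := Ring.inverse) (f := fun c : ℝ => 1 - (volterra A + c • volterra B))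
    ?_ (by fun_prop)
  rw [← hU]
  exact NormedRing.inverse_continuousAt
    (R := C(Set.Icc (0 : ℝ) 1, E) →L[ℝ] C(Set.Icc (0 : ℝ) 1, E)) U

theorem solFun_eq (A : C(ℝ, E →L[ℝ] E)) (v : E) {x : ℝ} (hx : x ∈ Set.Icc (0 : ℝ) 1) :
    solFun A v x = solOp A v ⟨x, hx⟩ :=
  (solOp_eq_iff.1 rfl ⟨x, hx⟩).symm

theorem hasDerivAt_solFun (A : C(ℝ, E →L[ℝ] E)) (v : E) {x : ℝ} (hx : x ∈ Set.Icc (0 : ℝ) 1) :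
    HasDerivAt (solFun A v) (A x (solFun A v x)) x := by
  have hc := continuous_volterraIntegrand A (solOp A v)
  have h := (hc.integral_hasStrictDerivAt 0 x).hasDerivAt.const_add v
  rw [solFun_eq A v hx, ← extendUnit_of_mem]
  exact h

theorem hasWeakDeriv_solFun (A : C(ℝ, E →L[ℝ] E)) (v : E) :
    HasWeakDeriv 1 (solFun A v) (fun x => A x (solFun A v x)) := by
  have hc : Continuous fun x => A x (solFun A v x) := A.continuous.clm_apply (continuous_solFun A v)
  refine ⟨?_, fun x hx => ?_⟩
  · obtain ⟨M, hM⟩ := isCompact_Icc.exists_bound_of_continuousOn hc.continuousOn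
    exact MemLp.of_bound hc.aestronglyMeasurable M
      ((ae_restrict_iff' measurableSet_Icc).2 (Filter.Eventually.of_forall hM))
  · have hderiv (t : ℝ) (ht : t ∈ Set.uIcc 0 x) :
        HasDerivAt (solFun A v) (A t (solFun A v t)) t := by
      rw [Set.uIcc_of_le hx.1] at ht
      exact hasDerivAt_solFun A v ⟨ht.1, ht.2.trans hx.2⟩
    rw [intervalIntegral.integral_eq_sub_of_hasDerivAt hderiv (hc.intervalIntegrable _ _),
      add_sub_cancel]

theorem HasWeakDeriv.eq_solFun {A : C(ℝ, E →L[ℝ] E)} {u g : ℝ → E} (h : HasWeakDeriv 1 u g)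
    (hg : ∀ᵐ x ∂(volume.restrict (Set.Icc (0 : ℝ) 1)), g x = A x (u x)) {x : ℝ}
    (hx : x ∈ Set.Icc (0 : ℝ) 1) : u x = solFun A (u 0) x := by
  let f : C(Set.Icc (0 : ℝ) 1, E) := ⟨(Set.Icc (0 : ℝ) 1).domRestrict u, h.continuousOn.domRestrict⟩
  have hf : solOp A (u 0) = f := by
    rw [solOp_eq_iff]
    intro y
    change u y = _
    rw [h.2 y y.2]
    congr 1
    refine intervalIntegral.integral_congr_ae ?_
    rw [ae_restrict_iff' measurableSet_Icc] at hg
    filter_upwards [hg] with t ht ht'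
    rw [Set.uIoc_of_le y.2.1] at ht'
    have ht1 : t ∈ Set.Icc (0 : ℝ) 1 := ⟨ht'.1.le, ht'.2.trans y.2.2⟩
    rw [ht ht1, extendUnit_of_mem f ht1]
    rfl
  rw [solFun_eq A _ hx, hf]
  rfl

end Volterra

/-! ### Boundary conditions and Lagrangian subspaces -/

section Boundary

/-- The projection `(p, q) ↦ p`. -/
def fstL (n : ℕ) : PhaseSpace n →L[ℝ] Vec n :=
  ContinuousLinearMap.fst ℝ _ _ ∘L EuclideanSpace.sumEquivProd.toContinuousLinearMap

/-- The projection `(p, q) ↦ q`. -/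
def sndL (n : ℕ) : PhaseSpace n →L[ℝ] Vec n :=
  ContinuousLinearMap.snd ℝ _ _ ∘L EuclideanSpace.sumEquivProd.toContinuousLinearMap

/-- The inclusion `p ↦ (p, 0)`. -/
def inlL (n : ℕ) : Vec n →L[ℝ] PhaseSpace n :=
  EuclideanSpace.sumEquivProd.symm.toContinuousLinearMap ∘L ContinuousLinearMap.inl ℝ _ _

/-- The inclusion `q ↦ (0, q)`. -/
def inrL (n : ℕ) : Vec n →L[ℝ] PhaseSpace n :=
  EuclideanSpace.sumEquivProd.symm.toContinuousLinearMap ∘L ContinuousLinearMap.inr ℝ _ _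

@[simp] theorem fstL_inlL (p : Vec n) : fstL n (inlL n p) = p := rfl

@[simp] theorem sndL_inlL (p : Vec n) : sndL n (inlL n p) = 0 := rfl

@[simp] theorem fstL_inrL (q : Vec n) : fstL n (inrL n q) = 0 := rfl

@[simp] theorem sndL_inrL (q : Vec n) : sndL n (inrL n q) = q := rfl

theorem fstL_apply (x : PhaseSpace n) (i : Fin n) : fstL n x i = x (Sum.inl i) := rfl

theorem sndL_apply (x : PhaseSpace n) (i : Fin n) : sndL n x i = x (Sum.inr i) := rfl

theorem phaseSpace_ext {x y : PhaseSpace n} (hfst : fstL n x = fstL n y)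
    (hsnd : sndL n x = sndL n y) : x = y := by
  ext (i | i)
  · exact congrArg (fun v : Vec n => v i) hfst
  · exact congrArg (fun v : Vec n => v i) hsnd

theorem omega_eq_sub (x y : PhaseSpace n) :
    omega x y = inner ℝ (fstL n x) (sndL n y) - inner ℝ (sndL n x) (fstL n y) := by
  rw [omega_eq_sum]
  simp [PiLp.inner_apply, fstL_apply, sndL_apply, mul_comm]

theorem mem_targetSpace {β₁ β₂ : Matrix (Fin n) (Fin n) ℝ} {v : PhaseSpace n} :
    v ∈ targetSpace β₁ β₂ ↔ BoundaryCond β₁ β₂ (fstL n v) (sndL n v) := Iff.rfl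

theorem mem_targetSpace_iff_mulVec {β₁ β₂ : Matrix (Fin n) (Fin n) ℝ} {v : PhaseSpace n} :
    v ∈ targetSpace β₁ β₂ ↔ (Matrix.fromCols β₁ β₂).mulVec v = 0 := by
  rw [mem_targetSpace, BoundaryCond, Matrix.fromCols_mulVec]
  rfl

/-- The span in `ℝ²ⁿ` of the rows of the block matrix `[β₁ β₂]`. -/
def rowSpace (β₁ β₂ : Matrix (Fin n) (Fin n) ℝ) : Submodule ℝ (PhaseSpace n) :=
  (LinearMap.range (Matrix.fromCols β₁ β₂).transpose.mulVecLin).map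
    (WithLp.linearEquiv 2 ℝ (Fin n ⊕ Fin n → ℝ)).symm.toLinearMap

theorem mem_rowSpace {β₁ β₂ : Matrix (Fin n) (Fin n) ℝ} {v : PhaseSpace n} :
    v ∈ rowSpace β₁ β₂ ↔
      ∃ z, WithLp.toLp 2 ((Matrix.fromCols β₁ β₂).transpose.mulVec z) = v := by
  constructor
  · rintro ⟨_, ⟨z, rfl⟩, rfl⟩
    exact ⟨z, rfl⟩
  · rintro ⟨z, rfl⟩
    exact ⟨_, ⟨z, rfl⟩, rfl⟩

theorem finrank_rowSpace (β₁ β₂ : Matrix (Fin n) (Fin n) ℝ) :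
    Module.finrank ℝ (rowSpace β₁ β₂) = (Matrix.fromCols β₁ β₂).rank :=
  (LinearEquiv.finrank_map_eq _ _).trans (Matrix.rank_transpose _)

theorem orthogonal_rowSpace (β₁ β₂ : Matrix (Fin n) (Fin n) ℝ) :
    (rowSpace β₁ β₂)ᗮ = targetSpace β₁ β₂ := by
  ext v
  have hinner (z : Fin n → ℝ) :
      inner ℝ (WithLp.toLp 2 ((Matrix.fromCols β₁ β₂).transpose.mulVec z)) v =
        (Matrix.fromCols β₁ β₂).mulVec v ⬝ᵥ z := by
    rw [EuclideanSpace.inner_eq_star_dotProduct, star_trivial, Matrix.mulVec_transpose,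
      dotProduct_comm, ← Matrix.dotProduct_mulVec, dotProduct_comm]
  simp only [Submodule.mem_orthogonal, mem_rowSpace, forall_exists_index,
    forall_apply_eq_imp_iff, hinner, dotProduct_eq_zero_iff, mem_targetSpace_iff_mulVec]

theorem map_Jmap_rowSpace_le {β₁ β₂ : Matrix (Fin n) (Fin n) ℝ}
    (h : β₁ * β₂.transpose - β₂ * β₁.transpose = 0) :
    (rowSpace β₁ β₂).map (Jmap n : PhaseSpace n →ₗ[ℝ] PhaseSpace n) ≤ targetSpace β₁ β₂ := by
  rintro _ ⟨_, hv, rfl⟩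
  obtain ⟨z, rfl⟩ := mem_rowSpace.1 hv
  set v : PhaseSpace n := WithLp.toLp 2 ((Matrix.fromCols β₁ β₂).transpose.mulVec z)
  have hfst : (fstL n (Jmap n v) : Fin n → ℝ) = -β₂.transpose.mulVec z := by
    ext i
    simp [v, fstL_apply, Matrix.transpose_fromCols, Matrix.fromRows_mulVec]
  have hsnd : (sndL n (Jmap n v) : Fin n → ℝ) = β₁.transpose.mulVec z := by
    ext i
    simp [v, sndL_apply, Matrix.transpose_fromCols, Matrix.fromRows_mulVec]
  change BoundaryCond β₁ β₂ (fstL n (Jmap n v)) (sndL n (Jmap n v))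
  rw [BoundaryCond, hfst, hsnd, Matrix.mulVec_neg, Matrix.mulVec_mulVec, Matrix.mulVec_mulVec,
    sub_eq_zero.1 h, neg_add_cancel]

theorem isLagrangian_targetSpace {β₁ β₂ : Matrix (Fin n) (Fin n) ℝ}
    (hrank : (Matrix.fromCols β₁ β₂).rank = n)
    (h : β₁ * β₂.transpose - β₂ * β₁.transpose = 0) : IsLagrangian (targetSpace β₁ β₂) := by
  have hrow : Module.finrank ℝ (rowSpace β₁ β₂) = n := (finrank_rowSpace β₁ β₂).trans hrank
  have hdim : Module.finrank ℝ (targetSpace β₁ β₂) = n := by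
    have hadd := Submodule.finrank_add_finrank_orthogonal (rowSpace β₁ β₂)
    rw [orthogonal_rowSpace, hrow, finrank_euclideanSpace, Fintype.card_sum,
      Fintype.card_fin] at hadd
    omega
  have hmap : (rowSpace β₁ β₂).map (Jmap n : PhaseSpace n →ₗ[ℝ] PhaseSpace n) =
      targetSpace β₁ β₂ := by
    refine Submodule.eq_of_le_of_finrank_eq (map_Jmap_rowSpace_le h) ?_
    rw [← (Submodule.equivMapOfInjective (Jmap n : PhaseSpace n →ₗ[ℝ] PhaseSpace n)
      Jmap_injective _).finrank_eq, hrow, hdim]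
  refine ⟨hdim, fun x hx y hy => ?_⟩
  rw [← hmap] at hx
  rw [← orthogonal_rowSpace] at hy
  obtain ⟨v, hv, rfl⟩ := hx
  change inner ℝ (Jmap n (Jmap n v)) y = 0
  rw [Jmap_Jmap, inner_neg_left, hy v hv, neg_zero]

end Boundary

/-! ### The Schrödinger equation as a first order system -/

section System

variable {V : ℝ → Matrix (Fin n) (Fin n) ℝ}

/-- The potential as an operator-valued continuous function on `ℝ`, constant on both sides of
`[0, 1]`. -/
def potOp (V : ℝ → Matrix (Fin n) (Fin n) ℝ) (hV : ContinuousOn V (Set.Icc 0 1)) :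
    C(ℝ, Vec n →L[ℝ] Vec n) where
  toFun x := Matrix.toEuclideanCLM (𝕜 := ℝ) (V (Set.projIcc (0 : ℝ) 1 zero_le_one x))
  continuous_toFun := by
    have hcont : Continuous (Matrix.toEuclideanCLM (𝕜 := ℝ) (n := Fin n)) :=
      LinearMap.continuous_of_finiteDimensional
        (Matrix.toEuclideanCLM (𝕜 := ℝ) (n := Fin n)).toAlgEquiv.toLinearMap
    exact hcont.comp (hV.comp_continuous (continuous_subtype_val.comp continuous_projIcc)
      fun x => (Set.projIcc (0 : ℝ) 1 zero_le_one x).2)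

/-- The coefficient `𝔸(x; λ)` of the system `(y, y')' = 𝔸(x; λ) (y, y')` as an operator-valued
continuous function on `ℝ`, constant on both sides of `[0, 1]`. -/
def sysOp (V : ℝ → Matrix (Fin n) (Fin n) ℝ) (hV : ContinuousOn V (Set.Icc 0 1)) (lam : ℝ) :
    C(ℝ, PhaseSpace n →L[ℝ] PhaseSpace n) :=
  ⟨fun x => inlL n ∘L sndL n + inrL n ∘L potOp V hV x ∘L fstL n,
    by have := (potOp V hV).continuous; fun_prop⟩ +
  (-lam) • ContinuousMap.const ℝ (inrL n ∘L fstL n)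

variable (hV : ContinuousOn V (Set.Icc 0 1))

theorem potOp_of_mem {x : ℝ} (hx : x ∈ Set.Icc (0 : ℝ) 1) :
    potOp V hV x = Matrix.toEuclideanCLM (𝕜 := ℝ) (V x) := by
  change Matrix.toEuclideanCLM (𝕜 := ℝ) (V (Set.projIcc (0 : ℝ) 1 zero_le_one x)) = _
  rw [Set.projIcc_of_mem zero_le_one hx]

theorem inner_potOp (hs : ∀ x ∈ Set.Icc (0 : ℝ) 1, (V x).IsSymm) (x : ℝ) (p q : Vec n) :
    inner ℝ (potOp V hV x p) q = inner ℝ p (potOp V hV x q) := by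
  set x₀ := Set.projIcc (0 : ℝ) 1 zero_le_one x
  have hstar : star (Matrix.toEuclideanCLM (𝕜 := ℝ) (V x₀)) =
      Matrix.toEuclideanCLM (𝕜 := ℝ) (V x₀) := by
    rw [← map_star, Matrix.star_eq_conjTranspose, Matrix.conjTranspose_eq_transpose_of_trivial,
      (hs x₀ x₀.2).eq]
  change inner ℝ (Matrix.toEuclideanCLM (𝕜 := ℝ) (V x₀) p) q = inner ℝ p
    (Matrix.toEuclideanCLM (𝕜 := ℝ) (V x₀) q)
  rw [← ContinuousLinearMap.adjoint_inner_right, ← ContinuousLinearMap.star_eq_adjoint, hstar]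

theorem sysOp_apply (lam x : ℝ) (v : PhaseSpace n) :
    sysOp V hV lam x v =
      inlL n (sndL n v) + inrL n (potOp V hV x (fstL n v) - lam • fstL n v) := by
  change inlL n (sndL n v) + inrL n (potOp V hV x (fstL n v)) + (-lam) • inrL n (fstL n v) = _
  rw [map_sub, map_smul]
  module

@[simp] theorem fstL_sysOp (lam x : ℝ) (v : PhaseSpace n) :
    fstL n (sysOp V hV lam x v) = sndL n v := by simp [sysOp_apply]

@[simp] theorem sndL_sysOp (lam x : ℝ) (v : PhaseSpace n) :
    sndL n (sysOp V hV lam x v) = potOp V hV x (fstL n v) - lam • fstL n v := by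
  simp [sysOp_apply]

theorem toEuclideanCLM_systemMatrix (lam : ℝ) {x : ℝ} (hx : x ∈ Set.Icc (0 : ℝ) 1)
    (v : PhaseSpace n) :
    Matrix.toEuclideanCLM (𝕜 := ℝ) (systemMatrix V lam x) v = sysOp V hV lam x v := by
  have helim : (v : Fin n ⊕ Fin n → ℝ) =
      Sum.elim (fstL n v : Fin n → ℝ) (sndL n v : Fin n → ℝ) := by
    ext (i | i) <;> rfl
  apply phaseSpace_ext
  · ext i
    rw [fstL_sysOp, fstL_apply, Matrix.ofLp_toEuclideanCLM, systemMatrix, helim,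
      Matrix.fromBlocks_mulVec]
    simp
  · ext i
    rw [sndL_sysOp, potOp_of_mem hV hx, sndL_apply, Matrix.ofLp_toEuclideanCLM, systemMatrix,
      helim, Matrix.fromBlocks_mulVec]
    simp [Matrix.sub_mulVec, Matrix.ofLp_toEuclideanCLM, Matrix.smul_mulVec]

theorem hasDerivAt_fstL_solFun (lam : ℝ) (v : PhaseSpace n) {x : ℝ}
    (hx : x ∈ Set.Icc (0 : ℝ) 1) :
    HasDerivAt (fun x => fstL n (solFun (sysOp V hV lam) v x))
      (sndL n (solFun (sysOp V hV lam) v x)) x :=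
  ((fstL n).hasFDerivAt.comp_hasDerivAt x (hasDerivAt_solFun _ v hx)).congr_deriv
    (fstL_sysOp hV lam x _)

theorem hasDerivAt_sndL_solFun (lam : ℝ) (v : PhaseSpace n) {x : ℝ}
    (hx : x ∈ Set.Icc (0 : ℝ) 1) :
    HasDerivAt (fun x => sndL n (solFun (sysOp V hV lam) v x))
      (potOp V hV x (fstL n (solFun (sysOp V hV lam) v x)) -
        lam • fstL n (solFun (sysOp V hV lam) v x)) x :=
  ((sndL n).hasFDerivAt.comp_hasDerivAt x (hasDerivAt_solFun _ v hx)).congr_deriv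
    (sndL_sysOp hV lam x _)

theorem eq_zero_of_fstL_solFun_eq_zero (lam : ℝ) {v : PhaseSpace n}
    (h : ∀ x ∈ Set.Icc (0 : ℝ) 1, fstL n (solFun (sysOp V hV lam) v x) = 0) : v = 0 := by
  have h0 : (0 : ℝ) ∈ Set.Icc (0 : ℝ) 1 := by simp
  have hfst : fstL n v = 0 := by simpa [solFun_zero] using h 0 h0
  have hsnd : sndL n v = 0 := by
    have hderiv := (hasDerivAt_fstL_solFun hV lam v h0).hasDerivWithinAt (s := Set.Icc 0 1)
    rw [solFun_zero] at hderiv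
    exact (uniqueDiffOn_Icc_zero_one 0 h0).eq_deriv _ hderiv
      ((hasDerivWithinAt_const (0 : ℝ) (Set.Icc (0 : ℝ) 1) (0 : Vec n)).congr h (h 0 h0))
  exact phaseSpace_ext (by rw [hfst, map_zero]) (by rw [hsnd, map_zero])

theorem continuous_solOp_sysOp : Continuous fun lam => solOp (sysOp V hV lam) :=
  (continuous_solOp _ _).comp continuous_neg

/-- The map `(y(0), y'(0)) ↦ (y(1), y'(1))` for the solutions of `-y'' + V y = λ y`. -/
def monodromy (lam : ℝ) : PhaseSpace n →L[ℝ] PhaseSpace n :=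
  ContinuousMap.evalCLM ℝ (⟨1, by simp⟩ : Set.Icc (0 : ℝ) 1) ∘L solOp (sysOp V hV lam)

theorem monodromy_apply (lam : ℝ) (v : PhaseSpace n) :
    monodromy hV lam v = solFun (sysOp V hV lam) v 1 :=
  (solFun_eq (sysOp V hV lam) v _).symm

theorem continuous_monodromy : Continuous fun lam => monodromy hV lam :=
  continuous_const.clm_comp (continuous_solOp_sysOp hV)

theorem mem_solutionSpace_iff {α₁ α₂ : Matrix (Fin n) (Fin n) ℝ} {lam : ℝ}
    {p : ℝ → PhaseSpace n} : p ∈ solutionSpace V α₁ α₂ 1 lam ↔ ∃ p' : ℝ → PhaseSpace n,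
      HasWeakDeriv 1 p p' ∧
      (∀ᵐ x ∂(volume.restrict (Set.Icc (0 : ℝ) 1)), p' x = sysOp V hV lam x (p x)) ∧
      p 0 ∈ targetSpace α₁ α₂ := by
  refine exists_congr fun p' => and_congr_right fun _ => and_congr ?_ Iff.rfl
  rw [ae_restrict_iff' measurableSet_Icc, ae_restrict_iff' measurableSet_Icc]
  refine Filter.eventually_congr (Filter.Eventually.of_forall fun x => forall_congr' fun hx => ?_)
  rw [toEuclideanCLM_systemMatrix hV lam hx]

theorem traceSpace_eq (α₁ α₂ : Matrix (Fin n) (Fin n) ℝ) (lam : ℝ) :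
    traceSpace V α₁ α₂ 1 lam = (targetSpace α₁ α₂).map (monodromy hV lam).toLinearMap := by
  ext v
  constructor
  · rintro ⟨p, hp, rfl⟩
    obtain ⟨p', hderiv, hode, hbc⟩ := (mem_solutionSpace_iff hV).1 hp
    refine ⟨p 0, hbc, ?_⟩
    change monodromy hV lam (p 0) = p 1
    rw [monodromy_apply, ← hderiv.eq_solFun hode (by simp)]
  · rintro ⟨w, hw, rfl⟩
    refine ⟨solFun (sysOp V hV lam) w, (mem_solutionSpace_iff hV).2
      ⟨_, hasWeakDeriv_solFun _ _, Filter.Eventually.of_forall fun _ => rfl, ?_⟩, ?_⟩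
    · rwa [solFun_zero]
    · exact (monodromy_apply hV lam w).symm

end System

/-! ### Solutions in `L²` -/

/-- The inclusion of `C([0, 1]; E)` into `L²([0, 1]; E)`. -/
def unitToL2 (E : Type*) [NormedAddCommGroup E] [NormedSpace ℝ E]
    [SecondCountableTopologyEither ℝ E] :
    C(Set.Icc (0 : ℝ) 1, E) →L[ℝ] Lp E 2 (volume.restrict (Set.Icc (0 : ℝ) 1)) :=
  BoundedContinuousFunction.toLp 2 (volume.restrict (Set.Icc (0 : ℝ) 1)) ℝ ∘L
    BoundedContinuousFunction.compContinuousCLM E ℝ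
      ⟨Set.projIcc (0 : ℝ) 1 zero_le_one, continuous_projIcc⟩ ∘L
    (ContinuousMap.linearIsometryBoundedOfCompact (Set.Icc (0 : ℝ) 1) E
      ℝ).toContinuousLinearEquiv.toContinuousLinearMap

theorem coeFn_unitToL2 {E : Type*} [NormedAddCommGroup E] [NormedSpace ℝ E]
    [SecondCountableTopologyEither ℝ E] (f : C(Set.Icc (0 : ℝ) 1, E)) :
    unitToL2 E f =ᵐ[volume.restrict (Set.Icc (0 : ℝ) 1)] extendUnit f :=
  BoundedContinuousFunction.coeFn_toLp 2 _ ℝ _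

section Solutions

variable {V : ℝ → Matrix (Fin n) (Fin n) ℝ} (hV : ContinuousOn V (Set.Icc 0 1))

/-- The solution `y` of `-y'' + V y = λ y` as an element of `L²`, as a function of
`(y(0), y'(0))`. -/
def solL2 (lam : ℝ) : PhaseSpace n →L[ℝ] L2 n :=
  (fstL n).compLpL 2 _ ∘L unitToL2 (PhaseSpace n) ∘L solOp (sysOp V hV lam)

theorem solL2_ae_eq (lam : ℝ) (v : PhaseSpace n) :
    solL2 hV lam v =ᵐ[volume.restrict (Set.Icc (0 : ℝ) 1)]
      fun x => fstL n (solFun (sysOp V hV lam) v x) := by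
  filter_upwards [(fstL n).coeFn_compLpL (unitToL2 (PhaseSpace n) (solOp (sysOp V hV lam) v)),
    coeFn_unitToL2 (solOp (sysOp V hV lam) v), ae_restrict_mem measurableSet_Icc]
    with x hcomp hunit hx
  rw [solFun_eq _ _ hx, ← extendUnit_of_mem, ← hunit]
  exact hcomp

theorem continuous_solL2 : Continuous fun lam => solL2 hV lam :=
  continuous_const.clm_comp (continuous_const.clm_comp (continuous_solOp_sysOp hV))

theorem solL2_injective (lam : ℝ) : Function.Injective (solL2 hV lam) := by
  refine (injective_iff_map_eq_zero (solL2 hV lam)).2 fun v hv => ?_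
  have hzero : (fun x => fstL n (solFun (sysOp V hV lam) v x))
      =ᵐ[volume.restrict (Set.Icc (0 : ℝ) 1)] fun _ => 0 :=
    (solL2_ae_eq hV lam v).symm.trans (hv ▸ Lp.coeFn_zero _ _ _)
  have hcont := (fstL n).continuous.comp (continuous_solFun (sysOp V hV lam) v)
  exact eq_zero_of_fstL_solFun_eq_zero hV lam fun x hx =>
    Measure.eqOn_Icc_of_ae_eq volume zero_ne_one hzero hcont.continuousOn continuousOn_const hx

theorem inner_solL2 (lam mu : ℝ) (v w : PhaseSpace n) :
    inner ℝ (solL2 hV lam v) (solL2 hV mu w) =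
      ∫ x in (0 : ℝ)..1, inner ℝ (fstL n (solFun (sysOp V hV lam) v x))
        (fstL n (solFun (sysOp V hV mu) w x)) := by
  rw [L2.inner_def, intervalIntegral.integral_of_le zero_le_one, ← integral_Icc_eq_integral_Ioc]
  refine integral_congr_ae ?_
  filter_upwards [solL2_ae_eq hV lam v, solL2_ae_eq hV mu w] with x hv hw
  rw [hv, hw]

theorem omega_monodromy (hs : ∀ x ∈ Set.Icc (0 : ℝ) 1, (V x).IsSymm) (lam mu : ℝ)
    (v w : PhaseSpace n) :
    omega (monodromy hV lam v) (monodromy hV mu w) =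
      omega v w + (lam - mu) * inner ℝ (solL2 hV lam v) (solL2 hV mu w) := by
  set y := solFun (sysOp V hV lam) v with hy
  set z := solFun (sysOp V hV mu) w with hz
  have hyc : Continuous y := continuous_solFun _ _
  have hzc : Continuous z := continuous_solFun _ _
  have hderiv (x : ℝ) (hx : x ∈ Set.uIcc (0 : ℝ) 1) : HasDerivAt (fun x => omega (y x) (z x))
      ((lam - mu) * inner ℝ (fstL n (y x)) (fstL n (z x))) x := by
    rw [Set.uIcc_of_le zero_le_one] at hx
    have hinner := ((Jmap n).hasFDerivAt.comp_hasDerivAt x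
      (hasDerivAt_solFun (sysOp V hV lam) v hx)).inner ℝ (hasDerivAt_solFun (sysOp V hV mu) w hx)
    refine hinner.congr_deriv ?_
    change omega (y x) (sysOp V hV mu x (z x)) + omega (sysOp V hV lam x (y x)) (z x) = _
    simp only [omega_eq_sub, fstL_sysOp, sndL_sysOp, inner_sub_left, inner_sub_right,
      inner_smul_left, inner_smul_right, inner_potOp hV hs, conj_trivial]
    ring
  have hint := intervalIntegral.integral_eq_sub_of_hasDerivAt hderiv
    (Continuous.intervalIntegrable (by fun_prop) _ _)
  rw [intervalIntegral.integral_const_mul, ← inner_solL2] at hint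
  rw [hint, hy, hz, solFun_zero, solFun_zero, monodromy_apply, monodromy_apply]
  ring

theorem monodromy_injective (hs : ∀ x ∈ Set.Icc (0 : ℝ) 1, (V x).IsSymm) (lam : ℝ) :
    Function.Injective (monodromy hV lam) := by
  refine (injective_iff_map_eq_zero (monodromy hV lam)).2 fun v hv => ?_
  have homega := omega_monodromy hV hs lam lam v (Jmap n v)
  rw [hv, sub_self, zero_mul, add_zero, omega_eq_inner, map_zero, inner_zero_left,
    omega_eq_inner, inner_Jmap_Jmap] at homega
  exact inner_self_eq_zero.1 homega.symm

end Solutions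

/-! ### Absence of very negative eigenvalues -/

theorem IsLagrangian.exists_bound {l : Submodule ℝ (PhaseSpace n)} (hl : IsLagrangian l) :
    ∃ C : ℝ, 0 ≤ C ∧ ∀ v ∈ l, |inner ℝ (fstL n v) (sndL n v)| ≤ C * ‖fstL n v‖ ^ 2 := by
  let f : l →ₗ[ℝ] Vec n := (fstL n).toLinearMap ∘ₗ l.subtype
  obtain ⟨g, hg⟩ := f.rangeRestrict.exists_rightInverse_of_surjective f.range_rangeRestrict
  let h : LinearMap.range f →L[ℝ] Vec n :=
    LinearMap.toContinuousLinearMap ((sndL n).toLinearMap ∘ₗ l.subtype ∘ₗ g)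
  refine ⟨‖h‖, h.opNorm_nonneg, fun v hv => ?_⟩
  let p : LinearMap.range f := f.rangeRestrict ⟨v, hv⟩
  have hfst : fstL n (g p) = fstL n v := congrArg Subtype.val (LinearMap.congr_fun hg p)
  have hinner : inner ℝ (fstL n v) (sndL n v) = inner ℝ (fstL n v) (h p) := by
    have homega := hl.2 v hv (v - g p) (l.sub_mem hv (g p).2)
    rwa [omega_eq_sub, map_sub, map_sub, hfst, sub_self, inner_zero_right, sub_zero,
      inner_sub_right, sub_eq_zero] at homega
  calc |inner ℝ (fstL n v) (sndL n v)| ≤ ‖fstL n v‖ * ‖h p‖ := by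
        rw [hinner]; exact abs_real_inner_le_norm _ _
    _ ≤ ‖fstL n v‖ * (‖h‖ * ‖fstL n v‖) := by gcongr; exact h.le_opNorm p
    _ = ‖h‖ * ‖fstL n v‖ ^ 2 := by ring

theorem norm_sq_le_of_lt {W : Type*} [NormedAddCommGroup W] [InnerProductSpace ℝ W]
    {T : W →L[ℝ] W} {M C s lam : ℝ} (hT : ‖T‖ ≤ M) (hC : 0 ≤ C) (hs : |s| ≤ 1)
    (hlam : lam < -(M + 2 * C + C ^ 2 + 1)) (p q : W) :
    ‖p‖ ^ 2 ≤ (inner ℝ p (T p - lam • p) + inner ℝ q q) -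
      (C * 2 * inner ℝ p p + C * s * (inner ℝ p q + inner ℝ q p)) := by
  have hTp : -(M * ‖p‖ ^ 2) ≤ inner ℝ p (T p) := by
    have hnorm : ‖p‖ * ‖T p‖ ≤ ‖p‖ * (M * ‖p‖) := by gcongr; exact T.le_of_opNorm_le hT p
    linarith [(abs_le.1 (abs_real_inner_le_norm p (T p))).1]
  have hpq : C * (s * inner ℝ p q) ≤ C * (‖p‖ * ‖q‖) := by
    refine mul_le_mul_of_nonneg_left ((le_abs_self _).trans ?_) hC
    rw [abs_mul]
    exact (mul_le_of_le_one_left (abs_nonneg _) hs).trans (abs_real_inner_le_norm _ _)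
  have hlam' : (M + 2 * C + C ^ 2 + 1) * ‖p‖ ^ 2 ≤ -lam * ‖p‖ ^ 2 :=
    mul_le_mul_of_nonneg_right (by linarith) (sq_nonneg _)
  simp only [inner_sub_right, inner_smul_right, real_inner_self_eq_norm_sq, real_inner_comm p q]
  nlinarith [sq_nonneg (‖q‖ - C * ‖p‖)]

section NegativeSpectrum

variable {V : ℝ → Matrix (Fin n) (Fin n) ℝ} (hV : ContinuousOn V (Set.Icc 0 1))

theorem norm_solL2_sq_le {M C lam : ℝ} (hM : ∀ x ∈ Set.Icc (0 : ℝ) 1, ‖potOp V hV x‖ ≤ M)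
    (hC : 0 ≤ C) (hlam : lam < -(M + 2 * C + C ^ 2 + 1)) (v : PhaseSpace n) :
    ‖solL2 hV lam v‖ ^ 2 ≤
      (inner ℝ (fstL n (monodromy hV lam v)) (sndL n (monodromy hV lam v)) -
        C * ‖fstL n (monodromy hV lam v)‖ ^ 2) -
      (inner ℝ (fstL n v) (sndL n v) + C * ‖fstL n v‖ ^ 2) := by
  set p : ℝ → Vec n := fun x => fstL n (solFun (sysOp V hV lam) v x) with hp
  set q : ℝ → Vec n := fun x => sndL n (solFun (sysOp V hV lam) v x) with hq
  have hpc : Continuous p := (fstL n).continuous.comp (continuous_solFun _ _)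
  have hqc : Continuous q := (sndL n).continuous.comp (continuous_solFun _ _)
  have hTc : Continuous (potOp V hV) := (potOp V hV).continuous
  -- The weight `C (2x - 1)` interpolates between the boundary terms `-C` at `0` and `C` at `1`.
  have hderiv (x : ℝ) (hx : x ∈ Set.uIcc (0 : ℝ) 1) :
      HasDerivAt (fun x => inner ℝ (p x) (q x) - C * (2 * x - 1) * inner ℝ (p x) (p x))
        ((inner ℝ (p x) (potOp V hV x (p x) - lam • p x) + inner ℝ (q x) (q x)) -
          (C * 2 * inner ℝ (p x) (p x) +
            C * (2 * x - 1) * (inner ℝ (p x) (q x) + inner ℝ (q x) (p x)))) x := by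
    rw [Set.uIcc_of_le zero_le_one] at hx
    have hpd := hasDerivAt_fstL_solFun hV lam v hx
    have hweight : HasDerivAt (fun x : ℝ => C * (2 * x - 1)) (C * 2) x := by
      simpa using (((hasDerivAt_id x).const_mul 2).sub_const 1).const_mul C
    exact (hpd.inner ℝ (hasDerivAt_sndL_solFun hV lam v hx)).sub
      (hweight.mul (hpd.inner ℝ hpd))
  have hint := intervalIntegral.integral_eq_sub_of_hasDerivAt hderiv
    (Continuous.intervalIntegrable (by fun_prop) _ _)
  calc ‖solL2 hV lam v‖ ^ 2 = ∫ x in (0 : ℝ)..1, ‖p x‖ ^ 2 := by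
        simp only [← real_inner_self_eq_norm_sq, inner_solL2, hp]
    _ ≤ _ := intervalIntegral.integral_mono_on zero_le_one
        (Continuous.intervalIntegrable (by fun_prop) _ _)
        (Continuous.intervalIntegrable (by fun_prop) _ _) fun x hx =>
          norm_sq_le_of_lt (s := 2 * x - 1) (hM x hx) hC
            (abs_le.2 ⟨by linarith [hx.1], by linarith [hx.2]⟩) hlam (p x) (q x)
    _ = _ := by
        rw [hint]
        simp only [hp, hq, solFun_zero, ← monodromy_apply, real_inner_self_eq_norm_sq]
        ring

theorem exists_forall_inf_eq_bot {l l₁ : Submodule ℝ (PhaseSpace n)} (hl : IsLagrangian l)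
    (hl₁ : IsLagrangian l₁) :
    ∃ L : ℝ, 0 < L ∧ ∀ lam < -L, l.map (monodromy hV lam).toLinearMap ⊓ l₁ = ⊥ := by
  obtain ⟨C₀, hC₀, hbound₀⟩ := hl.exists_bound
  obtain ⟨C₁, hC₁, hbound₁⟩ := hl₁.exists_bound
  obtain ⟨M, hM⟩ :=
    (isCompact_Icc (a := (0 : ℝ)) (b := 1)).exists_bound_of_continuousOn
      (potOp V hV).continuous.continuousOn
  have hM0 : 0 ≤ M := (norm_nonneg _).trans (hM 0 (by simp))
  refine ⟨M + 2 * (C₀ + C₁) + (C₀ + C₁) ^ 2 + 1, by positivity, fun lam hlam => ?_⟩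
  rw [eq_bot_iff]
  rintro _ ⟨⟨v, hv, rfl⟩, hw : monodromy hV lam v ∈ l₁⟩
  have hsq := norm_solL2_sq_le hV hM (add_nonneg hC₀ hC₁) hlam v
  have hle : ‖solL2 hV lam v‖ ^ 2 ≤ 0 := by
    have h0 := (abs_le.1 (hbound₀ v hv)).1
    have h1 := (abs_le.1 (hbound₁ _ hw)).2
    have h01 := mul_nonneg hC₀ (sq_nonneg ‖fstL n (monodromy hV lam v)‖)
    have h10 := mul_nonneg hC₁ (sq_nonneg ‖fstL n v‖)
    linarith
  have hzero : solL2 hV lam v = 0 :=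
    norm_eq_zero.1 (pow_eq_zero_iff two_ne_zero |>.1 (le_antisymm hle (sq_nonneg _)))
  rw [(map_eq_zero_iff _ (solL2_injective hV lam)).1 hzero]
  exact Submodule.mem_bot ℝ |>.2 (map_zero (monodromy hV lam))

end NegativeSpectrum

/-! ### Eigenspaces of the Schrödinger operator -/

theorem HasWeakDeriv.clm_comp {E F : Type*} [NormedAddCommGroup E] [NormedSpace ℝ E]
    [CompleteSpace E] [NormedAddCommGroup F] [NormedSpace ℝ F] [CompleteSpace F] {s : ℝ}
    {u g : ℝ → E} (h : HasWeakDeriv s u g) (T : E →L[ℝ] F) :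
    HasWeakDeriv s (fun x => T (u x)) (fun x => T (g x)) := by
  refine ⟨T.comp_memLp' h.1, fun x hx => ?_⟩
  beta_reduce
  rw [h.2 x hx, map_add, ← T.intervalIntegral_comp_comm (h.intervalIntegrable hx)]

section Eigenspaces

variable {V : ℝ → Matrix (Fin n) (Fin n) ℝ} (hV : ContinuousOn V (Set.Icc 0 1))
  {α₁ α₂ β₁ β₂ : Matrix (Fin n) (Fin n) ℝ}

theorem ae_toEuclideanCLM_eq_potOp : ∀ᵐ x ∂(volume.restrict (Set.Icc (0 : ℝ) 1)),
    Matrix.toEuclideanCLM (𝕜 := ℝ) (V x) = potOp V hV x :=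
  (ae_restrict_mem measurableSet_Icc).mono fun _ hx => (potOp_of_mem hV hx).symm

theorem phase_eq_solFun {lam : ℝ} {y y' y'' : ℝ → Vec n} (hy : HasWeakDeriv 1 y y')
    (hy' : HasWeakDeriv 1 y' y'')
    (hode : ∀ᵐ x ∂(volume.restrict (Set.Icc (0 : ℝ) 1)), y'' x = potOp V hV x (y x) - lam • y x)
    {x : ℝ} (hx : x ∈ Set.Icc (0 : ℝ) 1) :
    inlL n (y x) + inrL n (y' x) =
      solFun (sysOp V hV lam) (inlL n (y 0) + inrL n (y' 0)) x := by
  refine ((hy.clm_comp (inlL n)).add (hy'.clm_comp (inrL n))).eq_solFun ?_ hx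
  filter_upwards [hode] with x hx
  simp [sysOp_apply, hx]

theorem solL2_mem_eigenspaceH {mu : ℝ} {v : PhaseSpace n} (hv : v ∈ targetSpace α₁ α₂)
    (hw : monodromy hV mu v ∈ targetSpace β₁ β₂) :
    solL2 hV mu v ∈ eigenspaceH V α₁ α₂ β₁ β₂ mu := by
  set Y := solFun (sysOp V hV mu) v with hY
  have hderiv := hasWeakDeriv_solFun (sysOp V hV mu) v
  refine ⟨fun x => fstL n (Y x), fun x => sndL n (Y x),
    fun x => potOp V hV x (fstL n (Y x)) - mu • fstL n (Y x),
    by simpa using hderiv.clm_comp (fstL n), by simpa using hderiv.clm_comp (sndL n),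
    ?_, ?_, solL2_ae_eq hV mu v, ?_⟩
  · simpa only [hY, solFun_zero] using mem_targetSpace.1 hv
  · simpa only [monodromy_apply] using mem_targetSpace.1 hw
  · change ∀ᵐ x ∂_, (mu • solL2 hV mu v) x = _
    filter_upwards [solL2_ae_eq hV mu v, Lp.coeFn_smul mu (solL2 hV mu v),
      ae_toEuclideanCLM_eq_potOp hV] with x hsol hsmul hpot
    rw [hsmul, Pi.smul_apply, hsol, hpot]
    abel

theorem exists_solL2_eq_of_mem_eigenspaceH {mu : ℝ} {f : L2 n}
    (hf : f ∈ eigenspaceH V α₁ α₂ β₁ β₂ mu) :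
    ∃ v ∈ targetSpace α₁ α₂, monodromy hV mu v ∈ targetSpace β₁ β₂ ∧ solL2 hV mu v = f := by
  obtain ⟨y, y', y'', hy, hy', hα, hβ,
    (hfy : ∀ᵐ x ∂(volume.restrict (Set.Icc (0 : ℝ) 1)), f x = y x),
    (hHf : ∀ᵐ x ∂(volume.restrict (Set.Icc (0 : ℝ) 1)), (mu • f) x =
      -y'' x + Matrix.toEuclideanCLM (𝕜 := ℝ) (V x) (y x))⟩ := hf
  have hode : ∀ᵐ x ∂(volume.restrict (Set.Icc (0 : ℝ) 1)),
      y'' x = potOp V hV x (y x) - mu • y x := by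
    filter_upwards [hfy, hHf, Lp.coeFn_smul mu f, ae_toEuclideanCLM_eq_potOp hV]
      with x hfx hHx hsmul hpot
    rw [hsmul, Pi.smul_apply, hfx, hpot] at hHx
    rw [hHx]
    abel
  have hsol {x : ℝ} (hx : x ∈ Set.Icc (0 : ℝ) 1) := phase_eq_solFun hV hy hy' hode hx
  refine ⟨inlL n (y 0) + inrL n (y' 0), ?_, ?_, Lp.ext ?_⟩
  · simpa [mem_targetSpace] using hα
  · rw [monodromy_apply, ← hsol (by simp)]
    simpa [mem_targetSpace] using hβ
  · filter_upwards [hfy, solL2_ae_eq hV mu (inlL n (y 0) + inrL n (y' 0)),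
      ae_restrict_mem measurableSet_Icc] with x hfx hx hmem
    rw [hx, hfx, ← hsol hmem]
    simp

theorem eigenspaceH_eq (mu : ℝ) :
    eigenspaceH V α₁ α₂ β₁ β₂ mu =
      (targetSpace α₁ α₂ ⊓ (targetSpace β₁ β₂).comap (monodromy hV mu).toLinearMap).map
        (solL2 hV mu).toLinearMap := by
  ext f
  constructor
  · intro hf
    obtain ⟨v, hv, hw, rfl⟩ := exists_solL2_eq_of_mem_eigenspaceH hV hf
    exact ⟨v, ⟨hv, hw⟩, rfl⟩
  · rintro ⟨v, ⟨hv, hw⟩, rfl⟩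
    exact solL2_mem_eigenspaceH hV hv hw

include hV in
theorem toENat_rank_eigenspaceH (hs : ∀ x ∈ Set.Icc (0 : ℝ) 1, (V x).IsSymm)
    (α₁ α₂ β₁ β₂ : Matrix (Fin n) (Fin n) ℝ) (mu : ℝ) :
    Cardinal.toENat (Module.rank ℝ (eigenspaceH V α₁ α₂ β₁ β₂ mu)) =
      (Module.finrank ℝ (traceSpace V α₁ α₂ 1 mu ⊓ targetSpace β₁ β₂ :
        Submodule ℝ (PhaseSpace n)) : ℕ∞) := by
  have hfin : FiniteDimensional ℝ (eigenspaceH V α₁ α₂ β₁ β₂ mu) := by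
    rw [eigenspaceH_eq hV]
    infer_instance
  rw [← Module.finrank_eq_rank, Cardinal.toENat_nat, eigenspaceH_eq hV,
    ← (Submodule.equivMapOfInjective (solL2 hV mu).toLinearMap (solL2_injective hV mu)
      _).finrank_eq, traceSpace_eq hV, Submodule.map_inf_eq_map_inf_comap,
    ← (Submodule.equivMapOfInjective (monodromy hV mu).toLinearMap (monodromy_injective hV hs mu)
      _).finrank_eq]

end Eigenspaces

/-! ### The Morse index -/

/-- The path `t ↦ ℓ(1, -t)`, parametrized by the initial values in `{α₁ p + α₂ q = 0}`. -/
def schrodingerFrame {V : ℝ → Matrix (Fin n) (Fin n) ℝ} (hV : ContinuousOn V (Set.Icc 0 1))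
    (hs : ∀ x ∈ Set.Icc (0 : ℝ) 1, (V x).IsSymm) {α₁ α₂ : Matrix (Fin n) (Fin n) ℝ}
    (hα : IsLagrangian (targetSpace α₁ α₂)) : MonotoneFrame n (targetSpace α₁ α₂) (L2 n) where
  F t := monodromy hV (-t) ∘L (targetSpace α₁ α₂).subtypeL
  y t := solL2 hV (-t) ∘L (targetSpace α₁ α₂).subtypeL
  continuous_F := ((continuous_monodromy hV).comp continuous_neg).clm_comp continuous_const
  continuous_y := ((continuous_solL2 hV).comp continuous_neg).clm_comp continuous_const
  finrank_eq := hα.1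
  injective_F t := (monodromy_injective hV hs (-t)).comp Subtype.val_injective
  injective_y t := (solL2_injective hV (-t)).comp Subtype.val_injective
  omega_eq t s z w := by
    have homega := omega_monodromy hV hs (-t) (-s) z w
    rwa [hα.2 z z.2 w w.2, zero_add, neg_sub_neg] at homega

theorem tsum_natCast_eq_finsum_mem {ι : Type*} {s : Set ι} {d : ι → ℕ}
    (hfin : (s ∩ Function.support d).Finite) :
    ∑' x : s, (d x : ℕ∞) = ((∑ᶠ x ∈ s, d x : ℕ) : ℕ∞) := by
  have hsupp : (Function.support fun x : s => d x).Finite :=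
    (hfin.preimage Subtype.val_injective.injOn).subset fun x hx => ⟨x.2, hx⟩
  rw [← finsum_set_coe_eq_finsum_mem, ← Nat.coe_castAddMonoidHom,
    AddMonoidHom.map_finsum _ hsupp]
  exact tsum_eq_finsum (hsupp.subset fun x hx => by simpa using hx)

theorem tsum_Iio_comp_neg (d : ℝ → ℕ∞) :
    ∑' x : Set.Iio (0 : ℝ), d (-x) = ∑' x : Set.Ioi (0 : ℝ), d x :=
  ((Equiv.neg ℝ).subtypeEquiv (p := (· ∈ Set.Iio 0)) (q := (· ∈ Set.Ioi 0))
    fun x => by simp).tsum_eq fun x => d x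

section MorseIndex

variable {V : ℝ → Matrix (Fin n) (Fin n) ℝ} (hV : ContinuousOn V (Set.Icc 0 1))
  (hs : ∀ x ∈ Set.Icc (0 : ℝ) 1, (V x).IsSymm) {α₁ α₂ β₁ β₂ : Matrix (Fin n) (Fin n) ℝ}
  (hα : IsLagrangian (targetSpace α₁ α₂))

theorem schrodingerFrame_space (t : ℝ) :
    (schrodingerFrame hV hs hα).space t = traceSpace V α₁ α₂ 1 (-t) := by
  rw [traceSpace_eq hV]
  exact (LinearMap.range_comp _ _).trans (congrArg _ (Submodule.range_subtype _))

theorem schrodingerFrame_crossing (l₁ : Submodule ℝ (PhaseSpace n)) (t : ℝ) :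
    (schrodingerFrame hV hs hα).crossing l₁ t =
      Module.finrank ℝ (traceSpace V α₁ α₂ 1 (-t) ⊓ l₁ : Submodule ℝ (PhaseSpace n)) := by
  rw [MonotoneFrame.crossing, schrodingerFrame_space]

theorem morseIndex_eq_finsum_crossing (hβ : IsLagrangian (targetSpace β₁ β₂)) {L : ℝ}
    (hL : ∀ lam < -L, traceSpace V α₁ α₂ 1 lam ⊓ targetSpace β₁ β₂ = ⊥) :
    morseIndex V α₁ α₂ β₁ β₂ = ((∑ᶠ t ∈ Set.Ioc 0 L,
      (schrodingerFrame hV hs hα).crossing (targetSpace β₁ β₂) t : ℕ) : ℕ∞) := by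
  set d := (schrodingerFrame hV hs hα).crossing (targetSpace β₁ β₂)
  have hdim : ∀ t, d t = Module.finrank ℝ
      (traceSpace V α₁ α₂ 1 (-t) ⊓ targetSpace β₁ β₂ : Submodule ℝ (PhaseSpace n)) :=
    schrodingerFrame_crossing hV hs hα _
  have hd {t : ℝ} (ht : L < t) : d t = 0 := by
    rw [hdim, hL _ (neg_lt_neg ht), finrank_bot]
  have hsupp : Set.Ioi 0 ∩ Function.support d = Set.Ioc 0 L ∩ Function.support d := by
    ext t
    have (ht : d t ≠ 0) : t ≤ L := le_of_not_gt (mt hd ht)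
    simp only [Set.mem_inter_iff, Set.mem_Ioi, Set.mem_Ioc, Function.mem_support]
    tauto
  have hfin : (Set.Ioi 0 ∩ Function.support d).Finite := by
    rw [hsupp]
    exact (finite_Icc_inter_support
      ((schrodingerFrame hV hs hα).eventually_crossing_eq_zero hβ) 0 L).subset
      (Set.inter_subset_inter_left _ Set.Ioc_subset_Icc_self)
  calc morseIndex V α₁ α₂ β₁ β₂ = ∑' mu : Set.Iio (0 : ℝ), (d (-mu) : ℕ∞) :=
        tsum_congr fun mu => by
          rw [toENat_rank_eigenspaceH hV hs, hdim, neg_neg]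
    _ = ∑' t : Set.Ioi (0 : ℝ), (d t : ℕ∞) := tsum_Iio_comp_neg fun t => d t
    _ = ((∑ᶠ t ∈ Set.Ioi 0, d t : ℕ) : ℕ∞) := tsum_natCast_eq_finsum_mem hfin
    _ = ((∑ᶠ t ∈ Set.Ioc 0 L, d t : ℕ) : ℕ∞) := by
        rw [finsum_mem_inter_support_eq _ _ _ hsupp]

end MorseIndex

end MaslovMorse

end

theorem lemma3p6 (n : ℕ) (V : ℝ → Matrix (Fin n) (Fin n) ℝ)
    (α₁ α₂ β₁ β₂ : Matrix (Fin n) (Fin n) ℝ)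
    (hVcont : ContinuousOn V (Set.Icc 0 1))
    (hVsymm : ∀ x ∈ Set.Icc (0 : ℝ) 1, (V x).IsSymm)
    (hαrank : (Matrix.fromCols α₁ α₂).rank = n)
    (hβrank : (Matrix.fromCols β₁ β₂).rank = n)
    (hα : α₁ * α₂.transpose - α₂ * α₁.transpose = 0)
    (hβ : β₁ * β₂.transpose - β₂ * β₁.transpose = 0) :
    ∃ m : ℕ, morseIndex V α₁ α₂ β₁ β₂ = (m : ℕ∞) ∧
      (∃ L : ℝ, 0 < L ∧
        ∀ lam < -L, traceSpace V α₁ α₂ 1 lam ⊓ targetSpace β₁ β₂ = ⊥) ∧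
      ∀ L : ℝ, 0 < L →
        (∀ lam < -L, traceSpace V α₁ α₂ 1 lam ⊓ targetSpace β₁ β₂ = ⊥) →
        HasMaslovIndex (fun t => traceSpace V α₁ α₂ 1 (-t)) (targetSpace β₁ β₂) 0 L (m : ℤ) := by
  have hlα := isLagrangian_targetSpace hαrank hα
  have hlβ := isLagrangian_targetSpace hβrank hβ
  have hbound : ∃ L : ℝ, 0 < L ∧
      ∀ lam < -L, traceSpace V α₁ α₂ 1 lam ⊓ targetSpace β₁ β₂ = ⊥ := by
    simp only [traceSpace_eq hVcont]
    exact exists_forall_inf_eq_bot hVcont hlα hlβ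
  have ⟨L₀, _, hL₀⟩ := hbound
  have hmorse := morseIndex_eq_finsum_crossing hVcont hVsymm hlα hlβ hL₀
  refine ⟨_, hmorse, hbound, fun L hLpos hL => ?_⟩
  have hmaslov := (schrodingerFrame hVcont hVsymm hlα).hasMaslovIndex hlβ hLpos
  rwa [← Nat.cast_injective (R := ℕ∞)
      (hmorse.symm.trans (morseIndex_eq_finsum_crossing hVcont hVsymm hlα hlβ hL)),
    funext (schrodingerFrame_space hVcont hVsymm hlα)] at hmaslov
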